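/- In the Maximum Degree Contraction problem, an instance consists of a finite simple graph $G$ and integers $k,d\ge 0$, and the question is whether there is a set $F\subseteq E(G)$ with $|F|\le k$ such that every vertex of $G/F$ has degree at most $d$. Here $G/F$ is the simple graph obtained from $G$ by contracting each connected component of the subgraph formed by the edges in $F$ to a single vertex. The Exponential Time Hypothesis (ETH) states that there is a real number $\delta>0$ such that no algorithm decides the satisfiability of 3-CNF formulas in time $2^{\delta N}$ times a polynomial in the size of the formula, where $N$ is the number of variables of the formula. **Theorem.** Unless ETH fails, there is no algorithm that, given any instance $(G,k,d)$ of Maximum Degree Contraction, correctly determines whether it is a yes-instance and runs in time $n^{o(k)}$, where $n=|V(G)|$. That is, if ETH holds, then there are no algorithm $\mathcal A$ and function $g:\mathbb N\to\mathbb R$ with $g(k)/k\to 0$ as $k\to\infty$ such that $\mathcal A$ correctly decides all instances $(G,k,d)$ of Maximum Degree Contraction and takes at most $n^{g(k)}$ steps on all those with $n\ge 2$. (Algorithms are deterministic programs for a unit-cost random access machine with addition and subtraction, which agrees with Turing machines up to a polynomial in the running time.) -/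

import Mathlib

/-! ### Random access machines

The machine model is the unit-cost random access machine with the instruction set constants, copy,
addition, (truncated) subtraction, indirect load, indirect store, and tests for zero, with
structured control flow.  There is no unit-cost multiplication, so running times agree with
those of (multitape) Turing machines up to a polynomial. -/

/-- A state of the machine: finitely addressed registers (a program names them explicitly), and a
main memory, which is accessed indirectly through the registers.  All cells hold natural numbers. -/
structure RAMState where
  reg : ℕ → ℕ
  mem : ℕ → ℕ

/-- Programs of the random access machine. -/
inductive RAMProgram where
  /-- do nothing -/
  | skip : RAMProgram
  /-- `reg r := c` -/
  | const (r c : ℕ) : RAMProgram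
  /-- `reg r := reg a` -/
  | copy (r a : ℕ) : RAMProgram
  /-- `reg r := reg a + reg b` -/
  | add (r a b : ℕ) : RAMProgram
  /-- `reg r := max (reg a - reg b) 0` -/
  | sub (r a b : ℕ) : RAMProgram
  /-- `reg r := mem (reg a)` -/
  | load (r a : ℕ) : RAMProgram
  /-- `mem (reg a) := reg b` -/
  | store (a b : ℕ) : RAMProgram
  /-- first `P`, then `Q` -/
  | seq (P Q : RAMProgram) : RAMProgram
  /-- if `reg r ≠ 0` then `P` else `Q` -/
  | ite (r : ℕ) (P Q : RAMProgram) : RAMProgram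
  /-- while `reg r ≠ 0` do `P` -/
  | loop (r : ℕ) (P : RAMProgram) : RAMProgram

/-- Assignment to a register. -/
def RAMState.setReg (s : RAMState) (r v : ℕ) : RAMState :=
  { s with reg := Function.update s.reg r v }

/-- Assignment to a memory cell. -/
def RAMState.setMem (s : RAMState) (a v : ℕ) : RAMState :=
  { s with mem := Function.update s.mem a v }

/-- `RAMProgram.Runs P s t s'`: started in state `s`, the program `P` halts after exactly `t` steps,
in state `s'`.  Every instruction and every evaluation of a test costs one step. -/
inductive RAMProgram.Runs : RAMProgram → RAMState → ℕ → RAMState → Prop where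
  | skip (s : RAMState) : Runs .skip s 1 s
  | const (r c : ℕ) (s : RAMState) : Runs (.const r c) s 1 (s.setReg r c)
  | copy (r a : ℕ) (s : RAMState) : Runs (.copy r a) s 1 (s.setReg r (s.reg a))
  | add (r a b : ℕ) (s : RAMState) : Runs (.add r a b) s 1 (s.setReg r (s.reg a + s.reg b))
  | sub (r a b : ℕ) (s : RAMState) : Runs (.sub r a b) s 1 (s.setReg r (s.reg a - s.reg b))
  | load (r a : ℕ) (s : RAMState) : Runs (.load r a) s 1 (s.setReg r (s.mem (s.reg a)))
  | store (a b : ℕ) (s : RAMState) : Runs (.store a b) s 1 (s.setMem (s.reg a) (s.reg b))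
  | seq {P Q : RAMProgram} {s s' s'' : RAMState} {t t' : ℕ} :
      Runs P s t s' → Runs Q s' t' s'' → Runs (.seq P Q) s (t + t') s''
  | iteTrue {r : ℕ} {P Q : RAMProgram} {s s' : RAMState} {t : ℕ} :
      s.reg r ≠ 0 → Runs P s t s' → Runs (.ite r P Q) s (1 + t) s'
  | iteFalse {r : ℕ} {P Q : RAMProgram} {s s' : RAMState} {t : ℕ} :
      s.reg r = 0 → Runs Q s t s' → Runs (.ite r P Q) s (1 + t) s'
  | loopDone {r : ℕ} {P : RAMProgram} {s : RAMState} :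
      s.reg r = 0 → Runs (.loop r P) s 1 s
  | loopStep {r : ℕ} {P : RAMProgram} {s s' s'' : RAMState} {t t' : ℕ} :
      s.reg r ≠ 0 → Runs P s t s' → Runs (.loop r P) s' t' s'' →
        Runs (.loop r P) s (1 + t + t') s''

/-- The initial state on input `x`: the entries of `x` are in the memory cells `0, 1, 2, …`, and all
other cells and all registers hold `0`. -/
def RAMState.init (x : List ℕ) : RAMState where
  reg _ := 0
  mem i := x.getD i 0

/-- On input `x` the program `P` halts after exactly `t` steps and answers correctly whether `A`
holds.  (The answer is "yes" if register `0` is nonzero at the end, and "no" otherwise.) -/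
def RAMProgram.DecidesIn (P : RAMProgram) (x : List ℕ) (A : Prop) (t : ℕ) : Prop :=
  ∃ s : RAMState, P.Runs (RAMState.init x) t s ∧ (s.reg 0 ≠ 0 ↔ A)

/-! ### 3-SAT and the Exponential Time Hypothesis -/

/-- A 3-CNF formula: a list of clauses over the variables `0, …, numVars - 1`, each with three (not
necessarily distinct) literals.  The literal `(v, true)` is `v`, and `(v, false)` is `¬ v`. -/
structure ThreeCNF where
  numVars : ℕ
  clauses : List (Fin 3 → Fin numVars × Bool)

/-- Satisfiability: some assignment makes at least one literal of each clause true. -/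
def ThreeCNF.Satisfiable (φ : ThreeCNF) : Prop :=
  ∃ α : Fin φ.numVars → Bool, ∀ C ∈ φ.clauses, ∃ i : Fin 3, α (C i).1 = (C i).2

/-- The formula as an input: the numbers of variables and of clauses, and then each clause as
the list of the variables and signs of its literals. -/
def ThreeCNF.encode (φ : ThreeCNF) : List ℕ :=
  φ.numVars :: φ.clauses.length :: φ.clauses.flatMap fun C =>
    (List.finRange 3).flatMap fun i => [((C i).1 : ℕ), if (C i).2 then 1 else 0]

/-- 3-SAT can be solved in time `O*(2 ^ (δ n))`: some algorithm decides the satisfiability of all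
3-CNF formulas, in time `2 ^ (δ n)` times a polynomial in the size of the formula, where `n` is the
number of variables. -/
def ThreeSATSolvable (δ : ℝ) : Prop :=
  ∃ (P : RAMProgram) (c : ℕ), ∀ φ : ThreeCNF, ∃ t : ℕ, P.DecidesIn φ.encode φ.Satisfiable t ∧
    (t : ℝ) ≤ c * ((φ.numVars : ℝ) + φ.clauses.length + 1) ^ c * (2 : ℝ) ^ (δ * φ.numVars)

/-- The Exponential Time Hypothesis: for some `δ > 0`, there is no algorithm for 3-SAT that runs in
time `O*(2 ^ (δ n))`. -/
def ExponentialTimeHypothesis : Prop :=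
  ∃ δ : ℝ, 0 < δ ∧ ¬ ThreeSATSolvable δ

/-! ### Maximum Degree Contraction -/

/-- The graph `G / F` obtained by contracting the edges in `F`: its vertices are the connected
components of the graph `(V(G), F)` (a vertex not covered by `F` is a component of its own), and
two different components are adjacent if `G` has an edge between them. -/
def SimpleGraph.contractEdges {V : Type*} (G : SimpleGraph V) (F : Set (Sym2 V)) :
    SimpleGraph (SimpleGraph.fromEdgeSet F).ConnectedComponent where
  Adj a b := a ≠ b ∧ ∃ u v : V, G.Adj u v ∧
    (SimpleGraph.fromEdgeSet F).connectedComponentMk u = a ∧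
    (SimpleGraph.fromEdgeSet F).connectedComponentMk v = b
  symm := ⟨fun _ _ h => ⟨h.1.symm, by
    obtain ⟨u, v, huv, hu, hv⟩ := h.2
    exact ⟨v, u, huv.symm, hv, hu⟩⟩⟩
  loopless := ⟨fun _ h => h.1 rfl⟩

/-- `(G, k, d)` is a yes-instance of Maximum Degree Contraction: there is a set `F` of at most `k`
edges of `G` such that every vertex of `G / F` has degree at most `d`. -/
def MaximumDegreeContraction {n : ℕ} (G : SimpleGraph (Fin n)) (k d : ℕ) : Prop :=
  ∃ F : Finset (Sym2 (Fin n)), (F : Set (Sym2 (Fin n))) ⊆ G.edgeSet ∧ F.card ≤ k ∧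
    ∀ a, ((G.contractEdges (F : Set (Sym2 (Fin n)))).neighborSet a).ncard ≤ d

open Classical in
/-- The instance `(G, k, d)` as an input: the number `n` of vertices, `k`, `d`, and the adjacency
matrix of `G`, row by row. -/
noncomputable def encodeMDC {n : ℕ} (G : SimpleGraph (Fin n)) (k d : ℕ) : List ℕ :=
  n :: k :: d :: (List.finRange n).flatMap fun u =>
    (List.finRange n).map fun v => if G.Adj u v then 1 else 0

/-! The proof reduces 3-SAT to Maximum Degree Contraction, with the parameter `k` a constant built
into the reduction. Split the `N` variables into `k` groups of about `N / k`. Each partial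
assignment of a group is represented by an edge joining two "slots", a pair; choosing one pair per
group amounts to choosing an assignment. Every constraint has a vertex with exactly one neighbor for
each of the `W` slots: the slot itself if its pair satisfies the constraint, and a private leaf
otherwise. The degree bound is `W - 1`, so precisely the constraint vertices are too large, each by
one, and contracting a satisfying pair repairs a constraint vertex
(`maximumDegreeContraction_of_selection`).

For the converse, `k` edges touch at most `2 * k` vertices. For each group there are `2 * k + 1`
copies of the constraint "a pair of this group is chosen", so one copy is untouched. Its degree can
only drop if two of its neighbors are merged, and these must be slots of that group. Two touched
slots in each of `k` groups exhaust all `2 * k` touched vertices. Hence only slots are touched, the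
contracted edges are pairs, one per group, and every constraint vertex is untouched and has to be
repaired by one of them (`selection_of_maximumDegreeContraction`). With the clauses as further
constraints, this is satisfiability (`satisfiable_iff_selection`).

The graph has `n ≤ poly * 2 ^ (N / k)` vertices (`ThreeCNF.numVertices_le`), so `n ^ E` is a
polynomial times `2 ^ (N * E / k)`. Here `E` is `|g k|` plus a constant that pays for the reduction
itself. As `g k = o(k)`, some fixed `k` makes `E / k ≤ δ`, against ETH.

The reduction must be an actual machine program. Arithmetic expressions are compiled to programs
whose running time is polynomial in the values involved, rather than in their digits; this suffices
because the values stay polynomial in `n` (`reduction_runs`). -/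

/-! ### Running programs with time bounds -/

namespace RAMProgram

/-- Started in `s`, the program halts within `T` steps in a state with the property `post`. -/
def Halts (P : RAMProgram) (s : RAMState) (T : ℕ) (post : RAMState → Prop) : Prop :=
  ∃ t s', P.Runs s t s' ∧ t ≤ T ∧ post s'

theorem Halts.mono {P : RAMProgram} {s : RAMState} {T T' : ℕ} {post post' : RAMState → Prop}
    (h : P.Halts s T post) (hT : T ≤ T') (hp : ∀ s', post s' → post' s') :
    P.Halts s T' post' := by
  obtain ⟨t, s', h1, h2, h3⟩ := h
  exact ⟨t, s', h1, h2.trans hT, hp _ h3⟩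

theorem Halts.seq {P Q : RAMProgram} {s : RAMState} {T T' : ℕ} {mid post : RAMState → Prop}
    (h : P.Halts s T mid) (h' : ∀ s', mid s' → Q.Halts s' T' post) :
    (RAMProgram.seq P Q).Halts s (T + T') post := by
  obtain ⟨t, s', h1, h2, h3⟩ := h
  obtain ⟨t', s'', h4, h5, h6⟩ := h' s' h3
  exact ⟨_, _, .seq h1 h4, by omega, h6⟩

/-! ### Loop-free programs and counting loops -/

/-- The result of a loop-free program. -/
def exec : RAMProgram → RAMState → RAMState
  | .skip, s => s
  | .const r c, s => s.setReg r c
  | .copy r a, s => s.setReg r (s.reg a)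
  | .add r a b, s => s.setReg r (s.reg a + s.reg b)
  | .sub r a b, s => s.setReg r (s.reg a - s.reg b)
  | .load r a, s => s.setReg r (s.mem (s.reg a))
  | .store a b, s => s.setMem (s.reg a) (s.reg b)
  | .seq P Q, s => exec Q (exec P s)
  | .ite r P Q, s => if s.reg r ≠ 0 then exec P s else exec Q s
  | .loop _ _, s => s

/-- An upper bound for the running time of a loop-free program. -/
def len : RAMProgram → ℕ
  | .seq P Q => len P + len Q
  | .ite _ P Q => 1 + (len P + len Q)
  | _ => 1

/-- There is no loop in the program. -/
def LoopFree : RAMProgram → Prop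
  | .seq P Q => LoopFree P ∧ LoopFree Q
  | .ite _ P Q => LoopFree P ∧ LoopFree Q
  | .loop _ _ => False
  | _ => True

theorem LoopFree.halts {P : RAMProgram} (hP : P.LoopFree) (s : RAMState) :
    P.Halts s P.len (fun s' => s' = P.exec s) := by
  induction P generalizing s with
  | skip => exact ⟨_, _, .skip _, le_rfl, rfl⟩
  | const r c => exact ⟨_, _, .const .., le_rfl, rfl⟩
  | copy r a => exact ⟨_, _, .copy .., le_rfl, rfl⟩
  | add r a b => exact ⟨_, _, .add .., le_rfl, rfl⟩
  | sub r a b => exact ⟨_, _, .sub .., le_rfl, rfl⟩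
  | load r a => exact ⟨_, _, .load .., le_rfl, rfl⟩
  | store a b => exact ⟨_, _, .store .., le_rfl, rfl⟩
  | seq P Q ihP ihQ =>
    refine (ihP hP.1 s).seq (fun s' hs => ?_)
    subst hs
    exact ihQ hP.2 _
  | ite r P Q ihP ihQ =>
    by_cases h : s.reg r = 0
    · obtain ⟨t, s', h1, h2, h3⟩ := ihQ hP.2 s
      exact ⟨_, _, .iteFalse h h1, by simp only [len]; omega, by simp [exec, h, h3]⟩
    · obtain ⟨t, s', h1, h2, h3⟩ := ihP hP.1 s
      exact ⟨_, _, .iteTrue h h1, by simp only [len]; omega, by simp [exec, h, h3]⟩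
  | loop r P ih => exact hP.elim

theorem LoopFree.halts_of {P : RAMProgram} (hP : P.LoopFree) {s : RAMState} {T : ℕ}
    {post : RAMState → Prop} (hT : P.len ≤ T) (h : post (P.exec s)) : P.Halts s T post :=
  (hP.halts s).mono hT (fun _ hs => hs ▸ h)

/-- Loops that count down a register. -/
theorem Halts.loop {r : ℕ} {P : RAMProgram} {T : ℕ} {inv : ℕ → RAMState → Prop}
    (step : ∀ j s, s.reg r = j + 1 → inv (j + 1) s →
      P.Halts s T (fun s' => s'.reg r = j ∧ inv j s')) (j : ℕ) (s : RAMState)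
    (hr : s.reg r = j) (hs : inv j s) :
    (RAMProgram.loop r P).Halts s (j * (T + 1) + 1) (fun s' => s'.reg r = 0 ∧ inv 0 s') := by
  induction j generalizing s with
  | zero => exact ⟨_, _, .loopDone hr, by omega, hr, hs⟩
  | succ j ih =>
    obtain ⟨t, s', h1, h2, h3, h4⟩ := step j s hr hs
    obtain ⟨t', s'', h5, h6, h7⟩ := ih s' h3 h4
    refine ⟨_, _, .loopStep (by omega) h1 h5, ?_, h7⟩
    rw [add_mul]
    omega

/-! ### Returning the registers to zero -/

/-- A number above all registers that are written to. -/
def regBound : RAMProgram → ℕ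
  | .const r _ => r + 1
  | .copy r _ => r + 1
  | .add r _ _ => r + 1
  | .sub r _ _ => r + 1
  | .load r _ => r + 1
  | .seq P Q => max (regBound P) (regBound Q)
  | .ite _ P Q => max (regBound P) (regBound Q)
  | .loop _ P => regBound P
  | _ => 0

/-- A program names only finitely many registers. Those from the bound on keep their initial zero,
so clearing the ones below it restores the registers of an initial state. -/
theorem Runs.reg_eq {P : RAMProgram} {s s' : RAMState} {t : ℕ} (h : P.Runs s t s') :
    ∀ r, P.regBound ≤ r → s'.reg r = s.reg r := by
  induction h with
  | seq _ _ ih1 ih2 =>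
    intro r hr
    simp only [regBound, max_le_iff] at hr
    rw [ih2 r hr.2, ih1 r hr.1]
  | iteTrue _ _ ih =>
    intro r hr
    simp only [regBound, max_le_iff] at hr
    exact ih r hr.1
  | iteFalse _ _ ih =>
    intro r hr
    simp only [regBound, max_le_iff] at hr
    exact ih r hr.2
  | loopStep _ _ _ ih1 ih2 =>
    intro r hr
    rw [ih2 r hr, ih1 r hr]
  | _ =>
    intro r hr
    simp only [regBound] at hr
    simp [RAMState.setReg, RAMState.setMem, Function.update_apply]
    try omega

/-- Set the registers below `R` to zero. -/
def clear : ℕ → RAMProgram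
  | 0 => .skip
  | R + 1 => .seq (clear R) (.const R 0)

theorem clear_halts (R : ℕ) (s : RAMState) :
    (clear R).Halts s (R + 1)
      (fun s' => s'.mem = s.mem ∧ ∀ r, s'.reg r = if r < R then 0 else s.reg r) := by
  induction R with
  | zero => exact ⟨_, _, .skip _, le_rfl, rfl, by simp⟩
  | succ R ih =>
    obtain ⟨t, s', h1, h2, h3, h4⟩ := ih
    refine ⟨_, _, .seq h1 (.const ..), by omega, h3, fun r => ?_⟩
    simp only [RAMState.setReg, Function.update_apply, h4]
    split_ifs <;> first | rfl | omega

/-! ### Arithmetic -/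

/-- `reg r := 2 ^ reg r`, with scratch registers above `r`. -/
def powTwo (r : ℕ) : RAMProgram :=
  .seq (.seq (.const (r + 1) 1) (.const (r + 2) 1))
    (.seq (.loop r (.seq (.add (r + 1) (r + 1) (r + 1)) (.sub r r (r + 2)))) (.copy r (r + 1)))

theorem powTwo_halts (r : ℕ) (s : RAMState) :
    (powTwo r).Halts s (3 * s.reg r + 4)
      (fun s' => s'.mem = s.mem ∧ (∀ i < r, s'.reg i = s.reg i) ∧ s'.reg r = 2 ^ s.reg r) := by
  refine Halts.mono (Halts.seq (LoopFree.halts (by simp [LoopFree]) s) ?_)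
    (T := 2 + ((s.reg r * (2 + 1) + 1) + 1)) (by omega) (fun _ h => h)
  rintro _ rfl
  refine Halts.seq (Halts.loop
    (inv := fun j s' => s'.mem = s.mem ∧ (∀ i < r, s'.reg i = s.reg i) ∧ s'.reg (r + 2) = 1 ∧
      s'.reg (r + 1) * 2 ^ j = 2 ^ s.reg r) (T := 2) ?_ (s.reg r) _ ?_ ?_) ?_
  · rintro j s' h0 ⟨h1, h2, h3, h4⟩
    refine LoopFree.halts_of (by simp [LoopFree]) le_rfl ?_
    simp only [exec, RAMState.setReg, Function.update_apply]
    simp +contextual [h0, h1, h2, h3, ← h4, Nat.ne_of_lt, pow_succ]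
    exact ⟨fun i hi => by omega, by ring⟩
  · simp [exec, RAMState.setReg]
  · simp [exec, RAMState.setReg, Function.update_apply]
    intro i hi
    rw [if_neg (by omega), if_neg (by omega)]
  · rintro s' ⟨h0, h1, h2, h3, h4⟩
    refine LoopFree.halts_of (by simp [LoopFree]) le_rfl ?_
    simp at h4
    simp +contextual [exec, RAMState.setReg, h1, h2, h4, Nat.ne_of_lt]

/-- `reg r := reg r * reg (r + 1)`, with scratch registers above `r`. -/
def times (r : ℕ) : RAMProgram :=
  .seq (.seq (.const (r + 2) 0) (.const (r + 3) 1))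
    (.seq (.loop r (.seq (.add (r + 2) (r + 2) (r + 1)) (.sub r r (r + 3)))) (.copy r (r + 2)))

theorem times_halts (r : ℕ) (s : RAMState) :
    (times r).Halts s (3 * s.reg r + 4)
      (fun s' => s'.mem = s.mem ∧ (∀ i < r, s'.reg i = s.reg i) ∧
        s'.reg r = s.reg r * s.reg (r + 1)) := by
  refine Halts.mono (Halts.seq (LoopFree.halts (by simp [LoopFree]) s) ?_)
    (T := 2 + ((s.reg r * (2 + 1) + 1) + 1)) (by omega) (fun _ h => h)
  rintro _ rfl
  refine Halts.seq (Halts.loop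
    (inv := fun j s' => s'.mem = s.mem ∧ (∀ i < r, s'.reg i = s.reg i) ∧ s'.reg (r + 3) = 1 ∧
      s'.reg (r + 1) = s.reg (r + 1) ∧
      s'.reg (r + 2) + j * s.reg (r + 1) = s.reg r * s.reg (r + 1)) (T := 2) ?_ (s.reg r) _ ?_ ?_) ?_
  · rintro j s' h0 ⟨h1, h2, h3, h4, h5⟩
    refine LoopFree.halts_of (by simp [LoopFree]) le_rfl ?_
    simp only [exec, RAMState.setReg, Function.update_apply]
    simp [h0, h1, h3, h4, ← h5]
    refine ⟨fun i hi => ?_, by ring⟩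
    rw [if_neg (by omega), if_neg (by omega), h2 i hi]
  · simp [exec, RAMState.setReg]
  · simp [exec, RAMState.setReg, Function.update_apply]
    intro i hi
    rw [if_neg (by omega), if_neg (by omega)]
  · rintro s' ⟨h0, h1, h2, h3, h4, h5⟩
    refine LoopFree.halts_of (by simp [LoopFree]) le_rfl ?_
    simp at h5
    simp +contextual [exec, RAMState.setReg, h1, h2, h5, Nat.ne_of_lt]

/-- `reg (r + 2) := reg r / reg (r + 1)` and `reg (r + 3) := reg r % reg (r + 1)`, with scratch
registers above `r`. -/
def divMod (r : ℕ) : RAMProgram :=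
  .seq (.seq (.const (r + 2) 0) (.seq (.const (r + 3) 0) (.const (r + 4) 1)))
    (.loop r (.seq (.add (r + 3) (r + 3) (r + 4))
      (.seq (.sub (r + 5) (r + 1) (r + 3)) (.seq (.sub (r + 6) (r + 3) (r + 1))
      (.seq (.add (r + 5) (r + 5) (r + 6))
      (.seq (.ite (r + 5) .skip (.seq (.const (r + 3) 0) (.add (r + 2) (r + 2) (r + 4))))
      (.sub r r (r + 4))))))))

/-- One step of division by counting: the remainder goes up, and wraps around at `y`. The recursion
also holds for `y = 0` with the conventions `x / 0 = 0` and `x % 0 = x`, so `divMod` needs no side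
condition. -/
theorem _root_.Nat.succ_divMod (x y : ℕ) :
    (x + 1) / y = (if x % y + 1 = y then x / y + 1 else x / y) ∧
    (x + 1) % y = if x % y + 1 = y then 0 else x % y + 1 := by
  rcases Nat.eq_zero_or_pos y with rfl | hy
  · simp
  have h1 := Nat.div_add_mod x y
  have h2 := Nat.mod_lt x hy
  split_ifs with h
  · rw [Nat.div_mod_unique hy]
    refine ⟨?_, hy⟩
    rw [mul_add]; omega
  · rw [Nat.div_mod_unique hy]
    refine ⟨?_, ?_⟩ <;> omega

/-- The time depends on the dividend only. This matters for shifts, where the divisor is a power of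
two that may be exponentially large. -/
theorem divMod_halts (r : ℕ) (s : RAMState) :
    (divMod r).Halts s (10 * s.reg r + 4)
      (fun s' => s'.mem = s.mem ∧ (∀ i < r, s'.reg i = s.reg i) ∧
        s'.reg (r + 2) = s.reg r / s.reg (r + 1) ∧ s'.reg (r + 3) = s.reg r % s.reg (r + 1)) := by
  refine Halts.mono (Halts.seq (LoopFree.halts (by simp [LoopFree]) s) ?_)
    (T := 3 + (s.reg r * (9 + 1) + 1)) (by omega) (fun _ h => h)
  rintro _ rfl
  refine Halts.mono (Halts.loop
    (inv := fun j s' => s'.mem = s.mem ∧ (∀ i < r, s'.reg i = s.reg i) ∧ s'.reg (r + 4) = 1 ∧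
      s'.reg (r + 1) = s.reg (r + 1) ∧ j ≤ s.reg r ∧
      s'.reg (r + 2) = (s.reg r - j) / s.reg (r + 1) ∧
      s'.reg (r + 3) = (s.reg r - j) % s.reg (r + 1)) (T := 9) ?_ (s.reg r) _ ?_ ?_) le_rfl ?_
  · rintro j s' h0 ⟨h1, h2, h3, h4, h5, h6, h7⟩
    refine LoopFree.halts_of (by simp [LoopFree]) le_rfl ?_
    have e : s.reg r - j = (s.reg r - (j + 1)) + 1 := by omega
    obtain ⟨e1, e2⟩ := Nat.succ_divMod (s.reg r - (j + 1)) (s.reg (r + 1))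
    rw [e, e1, e2]
    generalize s.reg (r + 1) = y at *
    generalize (s.reg r - (j + 1)) / y = q at *
    generalize (s.reg r - (j + 1)) % y = z at *
    have hj : j ≤ s.reg r := by omega
    by_cases hz : z + 1 = y
    · simp [exec, RAMState.setReg, Function.update_apply, h0, h1, h3, h4, h6, h7, hz, hj]
      intro i hi
      split_ifs <;> first | omega | exact h2 i hi
    · obtain ⟨w, hw⟩ : ∃ w, y - (z + 1) + (z + 1 - y) = w + 1 :=
        ⟨y - (z + 1) + (z + 1 - y) - 1, by omega⟩
      simp [-Nat.add_eq_zero_iff, exec, RAMState.setReg, Function.update_apply, h0, h1,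
        h3, h4, h6, h7, hz, hj, hw]
      intro i hi
      split_ifs <;> first | omega | exact h2 i hi
  · simp [exec, RAMState.setReg]
  · simp [exec, RAMState.setReg, Function.update_apply]
    intro i hi
    rw [if_neg (by omega), if_neg (by omega), if_neg (by omega)]
  · rintro s' ⟨h0, h1, h2, h3, h4, h5, h6, h7⟩
    exact ⟨h1, h2, by simpa using h6, by simpa using h7⟩

end RAMProgram

/-! ### Arithmetic expressions -/

/-- Binary operations of arithmetic expressions; `shr x y` is `x / 2 ^ y`. -/
inductive ArithOp where
  | add | sub | mul | div | mod | shr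

namespace ArithOp

/-- The value of an operation. -/
def eval : ArithOp → ℕ → ℕ → ℕ
  | add, x, y => x + y
  | sub, x, y => x - y
  | mul, x, y => x * y
  | div, x, y => x / y
  | mod, x, y => x % y
  | shr, x, y => x / 2 ^ y

/-- The program that performs an operation on the registers `b` and `b + 1`, with result in
register `b` and scratch registers above. -/
def code : ArithOp → ℕ → RAMProgram
  | add, b => .add b b (b + 1)
  | sub, b => .sub b b (b + 1)
  | mul, b => .times b
  | div, b => .seq (.divMod b) (.copy b (b + 2))
  | mod, b => .seq (.divMod b) (.copy b (b + 3))
  | shr, b => .seq (.powTwo (b + 1)) (.seq (.divMod b) (.copy b (b + 2)))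

theorem eval_le (o : ArithOp) (x y : ℕ) : o.eval x y ≤ (x + 1) * (y + 1) := by
  have h : x + y + x * y + 1 = (x + 1) * (y + 1) := by ring
  cases o
  · simp only [eval]; omega
  · simp only [eval]; omega
  · simp only [eval]; omega
  · have := Nat.div_le_self x y
    simp only [eval]; omega
  · have := Nat.mod_le x y
    simp only [eval]; omega
  · have := Nat.div_le_self x (2 ^ y)
    simp only [eval]; omega

/-- The bound involves the operands alone: for `shr` the power is made by `y` doublings, and
dividing by it takes time linear in `x`. -/
theorem code_halts (o : ArithOp) (b : ℕ) (s : RAMState) :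
    (o.code b).Halts s (16 * ((s.reg b + 1) * (s.reg (b + 1) + 1))) (fun s' => s'.mem = s.mem ∧
      (∀ i < b, s'.reg i = s.reg i) ∧ s'.reg b = o.eval (s.reg b) (s.reg (b + 1))) := by
  have h : s.reg b + s.reg (b + 1) + s.reg b * s.reg (b + 1) + 1 =
    (s.reg b + 1) * (s.reg (b + 1) + 1) := by ring
  rw [← h]
  cases o
  · refine RAMProgram.LoopFree.halts_of (by simp [RAMProgram.LoopFree, code])
      (by simp only [RAMProgram.len, code]; omega) ?_
    simp +contextual [RAMProgram.exec, RAMState.setReg, eval, code, Nat.ne_of_lt]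
  · refine RAMProgram.LoopFree.halts_of (by simp [RAMProgram.LoopFree, code])
      (by simp only [RAMProgram.len, code]; omega) ?_
    simp +contextual [RAMProgram.exec, RAMState.setReg, eval, code, Nat.ne_of_lt]
  · exact (RAMProgram.times_halts b s).mono (by omega) (fun _ h => h)
  · refine RAMProgram.Halts.mono ((RAMProgram.divMod_halts b s).seq (T' := 1) ?_) (by omega)
      (fun _ h => h)
    rintro s' ⟨h1, h2, h3, h4⟩
    refine RAMProgram.LoopFree.halts_of (by simp [RAMProgram.LoopFree]) le_rfl ?_
    simp +contextual [RAMProgram.exec, RAMState.setReg, eval, Nat.ne_of_lt, h1, h2, h3]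
  · refine RAMProgram.Halts.mono ((RAMProgram.divMod_halts b s).seq (T' := 1) ?_) (by omega)
      (fun _ h => h)
    rintro s' ⟨h1, h2, h3, h4⟩
    refine RAMProgram.LoopFree.halts_of (by simp [RAMProgram.LoopFree]) le_rfl ?_
    simp +contextual [RAMProgram.exec, RAMState.setReg, eval, Nat.ne_of_lt, h1, h2, h4]
  · refine RAMProgram.Halts.mono ((RAMProgram.powTwo_halts (b + 1) s).seq
      (T' := 10 * s.reg b + 5) ?_) (by omega) (fun _ h => h)
    rintro s' ⟨h1, h2, h3⟩
    rw [← h2 b (by omega)]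
    refine RAMProgram.Halts.mono ((RAMProgram.divMod_halts b s').seq (T' := 1) ?_) (by omega)
      (fun _ h => h)
    rintro s'' ⟨h4, h5, h6, h7⟩
    refine RAMProgram.LoopFree.halts_of (by simp [RAMProgram.LoopFree]) le_rfl ?_
    simp +contextual [RAMProgram.exec, RAMState.setReg, eval, Nat.ne_of_lt, h1, h4, h5, h6, h3]
    intro i hi
    exact h2 i (by omega)

end ArithOp

/-- Arithmetic expressions over the registers and the memory. -/
inductive ArithExpr where
  | lit (c : ℕ) : ArithExpr
  | var (r : ℕ) : ArithExpr
  | ld (e : ArithExpr) : ArithExpr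
  | bin (o : ArithOp) (e e' : ArithExpr) : ArithExpr

namespace ArithExpr

/-- The value of an expression. -/
def eval (reg mem : ℕ → ℕ) : ArithExpr → ℕ
  | lit c => c
  | var r => reg r
  | ld e => mem (eval reg mem e)
  | bin o e e' => o.eval (eval reg mem e) (eval reg mem e')

/-- A number above all registers in the expression. -/
def varBound : ArithExpr → ℕ
  | lit _ => 0
  | var r => r + 1
  | ld e => varBound e
  | bin _ e e' => max (varBound e) (varBound e')

/-- The degree of a polynomial bound for the value and the evaluation time. -/
def deg : ArithExpr → ℕ
  | lit c => c + 1
  | var _ => 1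
  | ld e => deg e + 1
  | bin _ e e' => deg e + deg e' + 8

/-- The program that computes an expression into register `b`, with scratch registers above. -/
def compile : ArithExpr → ℕ → RAMProgram
  | lit c, b => .const b c
  | var r, b => .copy b r
  | ld e, b => .seq (compile e b) (.load b b)
  | bin o e e', b => .seq (compile e b) (.seq (compile e' (b + 1)) (o.code b))

theorem eval_congr (e : ArithExpr) {reg reg' mem : ℕ → ℕ}
    (h : ∀ i < e.varBound, reg i = reg' i) : e.eval reg mem = e.eval reg' mem := by
  induction e with
  | lit c => rfl
  | var r => exact h r (Nat.lt_succ_self r)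
  | ld e ih => simp only [eval, ih h]
  | bin o e e' ih ih' =>
    simp only [varBound, lt_max_iff] at h
    simp only [eval, ih (fun i hi => h i (Or.inl hi)), ih' (fun i hi => h i (Or.inr hi))]

/-- Since `2 ≤ B`, constants are absorbed into the exponent: `c < 2 ^ c ≤ B ^ c` for literals, and
the summand `8` in the degree of a binary operation covers the constant factors of both value and
time. -/
theorem eval_le_pow (e : ArithExpr) {reg mem : ℕ → ℕ} {B : ℕ} (hB : 2 ≤ B)
    (hr : ∀ i < e.varBound, reg i ≤ B) (hm : ∀ a, mem a ≤ B) : e.eval reg mem ≤ B ^ e.deg := by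
  have h1 : 1 ≤ B := by omega
  induction e with
  | lit c =>
    exact (Nat.lt_two_pow_self (n := c)).le.trans ((Nat.pow_le_pow_left hB c).trans
      (Nat.pow_le_pow_right h1 (by simp [deg])))
  | var r => simpa [deg, eval] using hr r (Nat.lt_succ_self r)
  | ld e ih => exact (hm _).trans (Nat.le_self_pow (by simp [deg]) B)
  | bin o e e' ih ih' =>
    simp only [varBound, lt_max_iff] at hr
    refine (o.eval_le _ _).trans ?_
    have := ih (fun i hi => hr i (Or.inl hi))
    have := ih' (fun i hi => hr i (Or.inr hi))
    have := Nat.one_le_pow e.deg B h1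
    have := Nat.one_le_pow e'.deg B h1
    calc _ ≤ (2 * B ^ e.deg) * (2 * B ^ e'.deg) := Nat.mul_le_mul (by omega) (by omega)
      _ = B ^ (e.deg + e'.deg) * 2 ^ 2 := by ring
      _ ≤ B ^ (e.deg + e'.deg) * B ^ 8 := by
        exact Nat.mul_le_mul_left _
          ((Nat.pow_le_pow_left hB 2).trans (Nat.pow_le_pow_right h1 (by norm_num)))
      _ = _ := by rw [deg, pow_add _ (_ + _)]

theorem compile_halts (e : ArithExpr) (b : ℕ) (s : RAMState) {B : ℕ} (hB : 2 ≤ B)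
    (hb : e.varBound ≤ b) (hr : ∀ i < b, s.reg i ≤ B) (hm : ∀ a, s.mem a ≤ B) :
    (e.compile b).Halts s (B ^ e.deg) (fun s' => s'.mem = s.mem ∧
      (∀ i < b, s'.reg i = s.reg i) ∧ s'.reg b = e.eval s.reg s.mem) := by
  have h1 : 1 ≤ B := by omega
  have hpos : ∀ d, 1 ≤ B ^ d := fun d => Nat.one_le_pow d B h1
  -- The induction only bounds the registers that `e` mentions. The second operand is computed at `b
  -- + 1`, while register `b` holds the value of the first, which may exceed `B`.
  suffices h : ∀ b (s : RAMState), e.varBound ≤ b → (∀ i < e.varBound, s.reg i ≤ B) →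
      (∀ a, s.mem a ≤ B) → (e.compile b).Halts s (B ^ e.deg) (fun s' => s'.mem = s.mem ∧
      (∀ i < b, s'.reg i = s.reg i) ∧ s'.reg b = e.eval s.reg s.mem) from
    h b s hb (fun i hi => hr i (hi.trans_le hb)) hm
  clear hb hr hm s b
  intro b s hb hr hm
  induction e generalizing b s with
  | lit c =>
    refine RAMProgram.LoopFree.halts_of (by simp [compile, RAMProgram.LoopFree]) (hpos _) ?_
    simp +contextual [RAMProgram.exec, compile, RAMState.setReg, eval, Nat.ne_of_lt]
  | var r =>
    refine RAMProgram.LoopFree.halts_of (by simp [compile, RAMProgram.LoopFree]) (hpos _) ?_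
    simp +contextual [RAMProgram.exec, compile, RAMState.setReg, eval, Nat.ne_of_lt]
  | ld e ih =>
    refine RAMProgram.Halts.mono ((ih b s hb hr hm).seq (T' := 1) ?_) ?_ (fun _ h => h)
    · rintro s' ⟨h2, h3, h4⟩
      refine RAMProgram.LoopFree.halts_of (by simp [RAMProgram.LoopFree]) le_rfl ?_
      simp +contextual [RAMProgram.exec, RAMState.setReg, eval, Nat.ne_of_lt, h2, h3, h4]
    · have := hpos e.deg
      rw [deg, pow_succ]
      nlinarith
  | bin o e e' ih ih' =>
    simp only [varBound, lt_max_iff, max_le_iff] at hr hb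
    have he := eval_le_pow e hB (fun i hi => hr i (Or.inl hi)) hm
    have he' := eval_le_pow e' hB (fun i hi => hr i (Or.inr hi)) hm
    have hp := hpos e.deg
    have hp' := hpos e'.deg
    refine RAMProgram.Halts.mono ((ih b s hb.1 (fun i hi => hr i (Or.inl hi)) hm).seq
      (T' := B ^ e'.deg + 16 * ((2 * B ^ e.deg) * (2 * B ^ e'.deg))) ?_) ?_ (fun _ h => h)
    · rintro s' ⟨h2, h3, h4⟩
      have hc : e'.eval s'.reg s'.mem = e'.eval s.reg s.mem := by
        rw [h2]
        exact e'.eval_congr (fun i hi => h3 i (by omega))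
      refine (ih' (b + 1) s' (by omega) (fun i hi => ?_) (by simpa [h2] using hm)).seq ?_
      · rw [h3 i (by omega)]
        exact hr i (Or.inr hi)
      rintro s'' ⟨h5, h6, h7⟩
      refine RAMProgram.Halts.mono (o.code_halts b s'') ?_ ?_
      · rw [h6 b (by omega), h7, h4, hc]
        gcongr <;> omega
      · rintro s3 ⟨h8, h9, h10⟩
        refine ⟨by rw [h8, h5, h2], fun i hi => ?_, ?_⟩
        · rw [h9 i hi, h6 i (by omega), h3 i hi]
        · rw [h10, h6 b (by omega), h7, h4, hc]
          rfl
    · have hx : B ^ e.deg ≤ B ^ (e.deg + e'.deg) := Nat.pow_le_pow_right h1 (by omega)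
      have hx' : B ^ e'.deg ≤ B ^ (e.deg + e'.deg) := Nat.pow_le_pow_right h1 (by omega)
      have h8 : 2 ^ 8 ≤ B ^ 8 := Nat.pow_le_pow_left hB 8
      calc _ = B ^ e.deg + B ^ e'.deg + 64 * B ^ (e.deg + e'.deg) := by ring
        _ ≤ B ^ (e.deg + e'.deg) * 2 ^ 8 := by omega
        _ ≤ B ^ (e.deg + e'.deg) * B ^ 8 := by gcongr
        _ = _ := by rw [deg, pow_add _ (_ + _)]

end ArithExpr

namespace RAMProgram

/-- `reg r := e`, with scratch registers from `b` on. -/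
def assign (b r : ℕ) (e : ArithExpr) : RAMProgram :=
  .seq (e.compile b) (.copy r b)

theorem assign_halts {b r : ℕ} (e : ArithExpr) (s : RAMState) {B : ℕ} (hB : 2 ≤ B)
    (hb : e.varBound ≤ b) (hr : ∀ i < b, s.reg i ≤ B) (hm : ∀ a, s.mem a ≤ B) :
    (assign b r e).Halts s (B ^ e.deg + 1) (fun s' => s'.mem = s.mem ∧
      ∀ i < b, s'.reg i = if i = r then e.eval s.reg s.mem else s.reg i) := by
  refine (e.compile_halts b s hB hb hr hm).seq ?_
  rintro s' ⟨h2, h3, h4⟩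
  refine RAMProgram.LoopFree.halts_of (by simp [RAMProgram.LoopFree]) le_rfl ?_
  simp +contextual [RAMProgram.exec, RAMState.setReg, h2, h3, h4, Function.update_apply]

/-- For all `i < reg cnt` in this order, `mem (reg lo + i) := e`, where `e` may use `i` as the
register `idx`. -/
def fill (b lo cnt idx : ℕ) (e : ArithExpr) : RAMProgram :=
  .seq (.const idx 0) (.loop cnt (.seq (e.compile b) (.seq (.seq (.add (b + 1) lo idx)
    (.seq (.store (b + 1) b) (.const (b + 1) 1)))
    (.seq (.add idx idx (b + 1)) (.sub cnt cnt (b + 1))))))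

/-- Each evaluation happens when the target block is partly overwritten. Therefore `he` asks for the
intended value in every state that agrees with the initial one outside the block and the two
counters, whatever the block contains. -/
theorem fill_halts {b lo cnt idx : ℕ} (e : ArithExpr) (s : RAMState) {B : ℕ} (hB : 2 ≤ B)
    (hlo : lo < b) (hcnt : cnt < b) (hidx : idx < b) (h1 : lo ≠ cnt) (h2 : lo ≠ idx)
    (h3 : cnt ≠ idx) (hb : e.varBound ≤ b) (hr : ∀ i < b, s.reg i ≤ B) (hm : ∀ a, s.mem a ≤ B)
    (val : ℕ → ℕ) (hv : ∀ i < s.reg cnt, val i ≤ B)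
    (he : ∀ i < s.reg cnt, ∀ s' : RAMState,
      (∀ j < b, j ≠ cnt → j ≠ idx → s'.reg j = s.reg j) → s'.reg idx = i →
      (∀ a, ¬ (s.reg lo ≤ a ∧ a < s.reg lo + s.reg cnt) → s'.mem a = s.mem a) →
      e.eval s'.reg s'.mem = val i) :
    (fill b lo cnt idx e).Halts s (B * (B ^ e.deg + 6) + 2) (fun s' =>
      (∀ j < b, j ≠ cnt → j ≠ idx → s'.reg j = s.reg j) ∧ s'.reg cnt = 0 ∧
      s'.reg idx = s.reg cnt ∧
      ∀ a, s'.mem a = if s.reg lo ≤ a ∧ a < s.reg lo + s.reg cnt then val (a - s.reg lo)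
        else s.mem a) := by
  refine RAMProgram.Halts.mono ((LoopFree.halts (P := .const idx 0) (by simp [LoopFree]) s).seq
    (T' := s.reg cnt * (B ^ e.deg + 6) + 1) ?_) ?_ (fun _ h => h)
  · rintro _ rfl
    refine RAMProgram.Halts.mono (Halts.loop (T := B ^ e.deg + 5)
      (inv := fun j s' => (∀ i < b, i ≠ cnt → i ≠ idx → s'.reg i = s.reg i) ∧
      j ≤ s.reg cnt ∧ s'.reg idx = s.reg cnt - j ∧
      ∀ a, s'.mem a = if s.reg lo ≤ a ∧ a < s.reg lo + (s.reg cnt - j) then val (a - s.reg lo)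
        else s.mem a) ?_ (s.reg cnt) _ ?_ ?_) le_rfl ?_
    · rintro j s' h0 ⟨h4, h5, h6, h7⟩
      refine (e.compile_halts b s' hB hb (fun i hi => ?_) (fun a => ?_)).seq ?_
      · by_cases hic : i = cnt
        · have := hr cnt hcnt
          subst hic
          omega
        by_cases hii : i = idx
        · have := hr cnt hcnt
          subst hii
          omega
        rw [h4 i hi hic hii]
        exact hr i hi
      · rw [h7]
        split_ifs with ha
        · exact hv _ (by omega)
        · exact hm a
      rintro s'' ⟨h8, h9, h10⟩
      have hev := he (s.reg cnt - (j + 1)) (by omega) s' h4 h6 (fun a ha => by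
        rw [h7, if_neg (by omega)])
      rw [hev] at h10
      refine LoopFree.halts_of (by simp [LoopFree]) le_rfl ?_
      have e1 := h9 lo hlo
      have e2 := h9 cnt hcnt
      have e3 := h9 idx hidx
      have e4 := h4 lo hlo h1 h2
      have n5 : cnt ≠ b + 1 := by omega
      have n6 : idx ≠ b + 1 := by omega
      simp only [exec, RAMState.setReg, RAMState.setMem, Function.update_apply]
      refine ⟨?_, fun i hi hi1 hi2 => ?_, by omega, ?_, fun a => ?_⟩
      · simp [h3, n5, n6.symm, e2, h0]
      · rw [if_neg hi1, if_neg hi2, if_neg (by omega), if_neg (by omega), h9 i hi,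
          h4 i hi hi1 hi2]
      · simp [h3.symm, n6, e3, h6]
        omega
      · simp [e1, e3, e4, h6, h8, h10]
        rw [h7]
        by_cases ha : a = s.reg lo + (s.reg cnt - (j + 1))
        · rw [if_pos ha, if_pos (by omega), ha]
          congr 1
          omega
        · rw [if_neg ha]
          by_cases ha' : s.reg lo ≤ a ∧ a < s.reg lo + (s.reg cnt - (j + 1))
          · rw [if_pos ha', if_pos (by omega)]
          · rw [if_neg ha', if_neg (by omega)]
    · simp [exec, RAMState.setReg, h3]
    · simp +contextual [exec, RAMState.setReg]
    · rintro s' ⟨h4, h5, h6, h7, h8⟩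
      exact ⟨h5, h4, by simpa using h7, by simpa using h8⟩
  · have := Nat.mul_le_mul_right (B ^ e.deg + 6) (hr cnt hcnt)
    simp only [len]
    omega

end RAMProgram

/-! ### Contractions and degrees -/

namespace SimpleGraph

variable {V : Type*}

theorem Reachable.exists_adj_of_ne {H : SimpleGraph V} {u v : V} (h : H.Reachable u v)
    (hne : u ≠ v) : ∃ w, H.Adj u w := by
  obtain ⟨p⟩ := h
  cases p with
  | nil => exact absurd rfl hne
  | cons h' _ => exact ⟨_, h'⟩

/-- Reachability is the smallest equivalence relation containing adjacency. -/
theorem Reachable.rel {H : SimpleGraph V} {r : V → V → Prop} (hr : Equivalence r)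
    (h : ∀ u v, H.Adj u v → r u v) {u v : V} (huv : H.Reachable u v) : r u v := by
  obtain ⟨p⟩ := huv
  induction p with
  | nil => exact hr.refl _
  | cons h' _ ih => exact hr.trans (h _ _ h') ih

/-- The neighbors of a component that consists of a single vertex. -/
theorem neighborSet_contractEdges_subset (G : SimpleGraph V) (F : Set (Sym2 V)) (u : V)
    (T : Set V) (hT : ∀ v w, (fromEdgeSet F).Reachable u v → G.Adj v w →
      (fromEdgeSet F).Reachable u w ∨ ∃ w' ∈ T, (fromEdgeSet F).Reachable w w') :
    (G.contractEdges F).neighborSet ((fromEdgeSet F).connectedComponentMk u) ⊆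
      (fromEdgeSet F).connectedComponentMk '' T := by
  rintro b ⟨hne, v, w, hvw, hv, hw⟩
  rcases hT v w (ConnectedComponent.exact hv).symm hvw with h | ⟨w', hw', h⟩
  · exact absurd ((ConnectedComponent.sound h).trans hw) hne
  · exact ⟨w', hw', (ConnectedComponent.sound h).symm.trans hw⟩

/-- If the degree of an untouched vertex drops, then two of its neighbors are in the same
component. -/
theorem exists_reachable_of_ncard_lt [Finite V] (G : SimpleGraph V) (F : Set (Sym2 V)) (u : V)
    (hu : ∀ w, ¬ (fromEdgeSet F).Adj u w) {W : ℕ} (g : Fin W → V) (hg : ∀ s, G.Adj u (g s))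
    (h : ((G.contractEdges F).neighborSet
      ((fromEdgeSet F).connectedComponentMk u)).ncard < W) :
    ∃ s s', s ≠ s' ∧ (fromEdgeSet F).Reachable (g s) (g s') := by
  by_contra! hc
  have hinj : Function.Injective fun s => (fromEdgeSet F).connectedComponentMk (g s) := by
    intro s s' hs
    by_contra hne
    exact hc s s' hne (ConnectedComponent.exact hs)
  refine absurd h (not_lt.2 ?_)
  have hsub : Set.range (fun s => (fromEdgeSet F).connectedComponentMk (g s)) ⊆
      (G.contractEdges F).neighborSet ((fromEdgeSet F).connectedComponentMk u) := by
    rintro _ ⟨s, rfl⟩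
    -- If `g s` were in the component of `u`, then `u` would lie on a contracted edge.
    refine ⟨fun he => ?_, u, g s, hg s, rfl, rfl⟩
    obtain ⟨w, hw⟩ := (ConnectedComponent.exact he).exists_adj_of_ne (hg s).ne
    exact hu w hw
  have := Set.ncard_le_ncard hsub (Set.toFinite _)
  rwa [← Set.image_univ, Set.ncard_image_of_injective _ hinj, Set.ncard_univ, Nat.card_fin] at this

end SimpleGraph

/-! ### The selection graph -/

section SelectionGraph

variable {Q W : ℕ}

/-- The constraint vertex in column `W` of row `q + 1` is linked, for each column `s < W`, to one
vertex in that column: in row `0` if the pair `s / 2` satisfies the constraint `q`, and in its own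
row otherwise. -/
def SelectionLink (W : ℕ) (sat : ℕ → ℕ → Prop) (r s r' s' : ℕ) : Prop :=
  s < W ∧ s' = W ∧ 0 < r' ∧ ((sat (r' - 1) (s / 2) ∧ r = 0) ∨ (¬ sat (r' - 1) (s / 2) ∧ r = r'))

/-- The vertices `2 p` and `2 p + 1` of row `0` form a pair. -/
def SelectionPair (W r s r' s' : ℕ) : Prop :=
  r = 0 ∧ r' = 0 ∧ s < W ∧ s' < W ∧ s / 2 = s' / 2 ∧ s ≠ s'

/-- Adjacency in the selection graph, in terms of rows and columns. -/
def SelectionAdj (W : ℕ) (sat : ℕ → ℕ → Prop) (r s r' s' : ℕ) : Prop :=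
  SelectionPair W r s r' s' ∨ SelectionLink W sat r s r' s' ∨ SelectionLink W sat r' s' r s

/-- The graph with rows `0, …, Q` and columns `0, …, W`, in which the vertices `2 p` and `2 p + 1`
of row `0` are joined, and the last vertex of row `q + 1` represents the constraint `q`. -/
def selectionGraph (Q W : ℕ) (sat : ℕ → ℕ → Prop) : SimpleGraph (Fin ((Q + 1) * (W + 1))) where
  Adj u v := SelectionAdj W sat (u / (W + 1)) (u % (W + 1)) (v / (W + 1)) (v % (W + 1))
  symm := ⟨fun u v h => by
    rcases h with ⟨h1, h2, h3, h4, h5, h6⟩ | h | h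
    · exact Or.inl ⟨h2, h1, h4, h3, h5.symm, h6.symm⟩
    · exact Or.inr (Or.inr h)
    · exact Or.inr (Or.inl h)⟩
  loopless := ⟨fun u h => by
    rcases h with ⟨_, _, _, _, _, h6⟩ | ⟨h1, h2, _⟩ | ⟨h1, h2, _⟩
    · exact h6 rfl
    · omega
    · omega⟩

/-- The vertex in row `r` and column `s` (truncated to the grid). -/
def gridVertex (Q W r s : ℕ) : Fin ((Q + 1) * (W + 1)) :=
  ⟨min r Q * (W + 1) + min s W, by
    have h1 : min r Q ≤ Q := min_le_right _ _
    have h2 : min s W ≤ W := min_le_right _ _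
    have h3 := Nat.mul_le_mul_right (W + 1) h1
    rw [add_mul Q]
    omega⟩

theorem gridVertex_div {r s : ℕ} (hr : r ≤ Q) :
    (gridVertex Q W r s : ℕ) / (W + 1) = r := by
  have h2 : min s W ≤ W := min_le_right _ _
  simp only [gridVertex]
  rw [min_eq_left hr, mul_comm, Nat.mul_add_div (Nat.succ_pos _),
    Nat.div_eq_of_lt (by omega), add_zero]

theorem gridVertex_mod {r s : ℕ} (hs : s ≤ W) : (gridVertex Q W r s : ℕ) % (W + 1) = s := by
  simp only [gridVertex]
  rw [min_eq_left hs, mul_comm, Nat.mul_add_mod, Nat.mod_eq_of_lt (by omega)]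

theorem gridVertex_of (u : Fin ((Q + 1) * (W + 1))) :
    gridVertex Q W (u / (W + 1)) (u % (W + 1)) = u := by
  have h1 : (u : ℕ) / (W + 1) < Q + 1 :=
    (Nat.div_lt_iff_lt_mul (Nat.succ_pos _)).2 u.2
  have h2 : (u : ℕ) % (W + 1) < W + 1 := Nat.mod_lt _ (Nat.succ_pos W)
  ext
  simp only [gridVertex]
  rw [min_eq_left (by omega), min_eq_left (by omega), mul_comm]
  exact Nat.div_add_mod _ _

theorem eq_gridVertex {u : Fin ((Q + 1) * (W + 1))} {r s : ℕ} (hr : (u : ℕ) / (W + 1) = r)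
    (hs : (u : ℕ) % (W + 1) = s) : u = gridVertex Q W r s := by
  rw [← hr, ← hs, gridVertex_of]

open Classical in
/-- The row of the neighbor of the constraint `q` in column `s`. -/
noncomputable def linkRow (sat : ℕ → ℕ → Prop) (q s : ℕ) : ℕ :=
  if sat q (s / 2) then 0 else q + 1

theorem linkRow_le {sat : ℕ → ℕ → Prop} {q s : ℕ} (hq : q < Q) : linkRow sat q s ≤ Q := by
  unfold linkRow
  split_ifs <;> omega

theorem selectionGraph_adj_link {sat : ℕ → ℕ → Prop} {q s : ℕ} (hq : q < Q) (hs : s < W) :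
    (selectionGraph Q W sat).Adj (gridVertex Q W (q + 1) W)
      (gridVertex Q W (linkRow sat q s) s) := by
  refine Or.inr (Or.inr ?_)
  rw [gridVertex_div (linkRow_le hq), gridVertex_div (by omega), gridVertex_mod hs.le,
    gridVertex_mod le_rfl]
  refine ⟨hs, rfl, by omega, ?_⟩
  by_cases h : sat q (s / 2) <;> simp [linkRow, h]

/-- Together with `selectionGraph_adj_link`, this shows that a constraint vertex has exactly one
neighbor in each column `s < W`, hence degree `W`, one more than allowed. -/
theorem eq_of_selectionGraph_adj {sat : ℕ → ℕ → Prop} {q : ℕ} (hq : q < Q)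
    {v : Fin ((Q + 1) * (W + 1))} (h : (selectionGraph Q W sat).Adj (gridVertex Q W (q + 1) W) v) :
    ∃ s < W, v = gridVertex Q W (linkRow sat q s) s := by
  change SelectionAdj _ _ _ _ _ _ at h
  rw [gridVertex_div (by omega), gridVertex_mod le_rfl] at h
  rcases h with ⟨h1, _⟩ | ⟨h1, _⟩ | ⟨h1, _, _, h4⟩
  · omega
  · omega
  · refine ⟨_, h1, eq_gridVertex ?_ rfl⟩
    rcases h4 with ⟨h5, h6⟩ | ⟨h5, h6⟩
    · rw [h6, linkRow, if_pos (by simpa using h5)]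
    · rw [h6, linkRow, if_neg (by simpa using h5)]

variable {k A : ℕ} {sat : ℕ → ℕ → Prop}

/-- Contract the selected pairs. A constraint vertex loses one neighbor when both slots of a
satisfying pair are merged, and all other components have at most `Q + 1 ≤ W - 1` neighbors. -/
theorem maximumDegreeContraction_of_selection (hW : W = 2 * (k * A)) (hA : 0 < A)
    (hQ : Q + 2 ≤ W) (p : Fin k → ℕ) (hp : ∀ i, p i / A = i) (hs : ∀ q < Q, ∃ i, sat q (p i)) :
    MaximumDegreeContraction (selectionGraph Q W sat) k (W - 1) := by
  classical
  have hpk : ∀ i, 2 * p i + 1 < W := fun i => by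
    have h1 : p i < k * A := by
      rw [← Nat.div_lt_iff_lt_mul hA, hp]
      exact i.2
    omega
  set F : Finset (Sym2 (Fin ((Q + 1) * (W + 1)))) := Finset.univ.image fun i : Fin k =>
    s(gridVertex Q W 0 (2 * p i), gridVertex Q W 0 (2 * p i + 1)) with hF
  set H := SimpleGraph.fromEdgeSet (F : Set (Sym2 (Fin ((Q + 1) * (W + 1))))) with hH
  have hadj : ∀ u v, H.Adj u v → (u : ℕ) / (W + 1) = 0 ∧ (v : ℕ) / (W + 1) = 0 ∧
      (u : ℕ) % (W + 1) < W ∧ (v : ℕ) % (W + 1) < W ∧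
      (u : ℕ) % (W + 1) / 2 = (v : ℕ) % (W + 1) / 2 := by
    intro u v h
    rw [hH, SimpleGraph.fromEdgeSet_adj, hF] at h
    obtain ⟨h, -⟩ := h
    simp only [Finset.coe_image, Finset.coe_univ, Set.image_univ, Set.mem_range,
      Sym2.eq_iff] at h
    obtain ⟨i, ⟨rfl, rfl⟩ | ⟨rfl, rfl⟩⟩ := h <;>
    · have := hpk i
      rw [gridVertex_div (by omega), gridVertex_div (by omega), gridVertex_mod (by omega),
        gridVertex_mod (by omega)]
      omega
  have hreach : ∀ u v, H.Reachable u v → u = v ∨ ((u : ℕ) / (W + 1) = 0 ∧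
      (v : ℕ) / (W + 1) = 0 ∧ (u : ℕ) % (W + 1) < W ∧ (v : ℕ) % (W + 1) < W ∧
      (u : ℕ) % (W + 1) / 2 = (v : ℕ) % (W + 1) / 2) := by
    intro u v h
    refine SimpleGraph.Reachable.rel (r := fun u v : Fin ((Q + 1) * (W + 1)) => u = v ∨ ((u : ℕ) / (W + 1) = 0 ∧
      (v : ℕ) / (W + 1) = 0 ∧ (u : ℕ) % (W + 1) < W ∧ (v : ℕ) % (W + 1) < W ∧
      (u : ℕ) % (W + 1) / 2 = (v : ℕ) % (W + 1) / 2)) ⟨fun _ => Or.inl rfl, fun h => ?_, fun h h' => ?_⟩ (fun u v h => Or.inr (hadj u v h)) h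
    · rcases h with rfl | h
      · exact Or.inl rfl
      · exact Or.inr ⟨h.2.1, h.1, h.2.2.2.1, h.2.2.1, h.2.2.2.2.symm⟩
    · rcases h with rfl | h
      · exact h'
      rcases h' with rfl | h'
      · exact Or.inr h
      · exact Or.inr ⟨h.1, h'.2.1, h.2.2.1, h'.2.2.2.1, h.2.2.2.2.trans h'.2.2.2.2⟩
  refine ⟨F, ?_, ?_, ?_⟩
  · intro e he
    simp only [hF, Finset.coe_image, Finset.coe_univ, Set.image_univ, Set.mem_range] at he
    obtain ⟨i, rfl⟩ := he
    have := hpk i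
    refine Or.inl ?_
    rw [gridVertex_div (by omega), gridVertex_div (by omega), gridVertex_mod (by omega),
      gridVertex_mod (by omega)]
    exact ⟨rfl, rfl, by omega, by omega, by omega, by omega⟩
  · exact Finset.card_image_le.trans (by simp)
  · intro a
    obtain ⟨u, rfl⟩ := a.exists_rep
    suffices h : ∃ T : Finset (Fin ((Q + 1) * (W + 1))), T.card ≤ W - 1 ∧
        ∀ v w, H.Reachable u v → (selectionGraph Q W sat).Adj v w →
          H.Reachable u w ∨ ∃ w' ∈ T, H.Reachable w w' by
      obtain ⟨T, hT, h⟩ := h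
      refine (Set.ncard_le_ncard (SimpleGraph.neighborSet_contractEdges_subset _ _ u (T : Set _) h)
        (Set.toFinite _)).trans ((Set.ncard_image_le (Set.toFinite _)).trans ?_)
      rwa [Set.ncard_coe_finset]
    by_cases hu : (u : ℕ) % (W + 1) = W ∧ 0 < (u : ℕ) / (W + 1)
    · obtain ⟨q, hq⟩ := Nat.exists_eq_add_of_lt hu.2
      rw [zero_add] at hq
      have hqQ : q < Q := by
        have h1 : (u : ℕ) / (W + 1) < Q + 1 :=
          (Nat.div_lt_iff_lt_mul (Nat.succ_pos _)).2 u.2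
        omega
      obtain ⟨i, hi⟩ := hs q hqQ
      have hi' := hpk i
      -- Column `2 * p i + 1` is dispensable: its slot is merged with the one in column `2 * p i`,
      -- which is also a neighbor because the pair `p i` satisfies `q`.
      refine ⟨((Finset.range W).erase (2 * p i + 1)).image
        fun s => gridVertex Q W (linkRow sat q s) s, ?_, ?_⟩
      · refine Finset.card_image_le.trans ?_
        rw [Finset.card_erase_of_mem (by simpa using hi'), Finset.card_range]
      · intro v w huv hvw
        have huv' : u = v := by
          rcases hreach u v huv with h | h
          · exact h
          · omega
        subst huv'
        rw [eq_gridVertex hq hu.1] at hvw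
        obtain ⟨s, hsW, rfl⟩ := eq_of_selectionGraph_adj hqQ hvw
        refine Or.inr ?_
        by_cases hsp : s = 2 * p i + 1
        · have e1 : (2 * p i + 1) / 2 = p i := by omega
          have e2 : 2 * p i / 2 = p i := by omega
          refine ⟨gridVertex Q W (linkRow sat q (2 * p i)) (2 * p i), ?_, ?_⟩
          · refine Finset.mem_image_of_mem _ ?_
            simp only [Finset.mem_erase, Finset.mem_range]
            omega
          · subst hsp
            rw [linkRow, linkRow, e1, e2, if_pos hi]
            refine SimpleGraph.Adj.reachable ?_
            rw [hH, SimpleGraph.fromEdgeSet_adj]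
            refine ⟨?_, fun h => ?_⟩
            · rw [hF, Finset.coe_image, Sym2.eq_swap]
              exact ⟨i, by simp, rfl⟩
            · have h1 := gridVertex_mod (Q := Q) (W := W) (r := 0) (s := 2 * p i + 1) (by omega)
              rw [h, gridVertex_mod (by omega)] at h1
              omega
        · exact ⟨_, Finset.mem_image_of_mem _ (by simp [hsp, hsW]), SimpleGraph.Reachable.refl _⟩
    -- Outside the constraint vertices, a component can only see the partner of `u` in its pair and
    -- the `Q` constraint vertices.
    · refine ⟨insert (gridVertex Q W 0 (if (u : ℕ) % (W + 1) % 2 = 0 then (u : ℕ) % (W + 1) + 1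
        else (u : ℕ) % (W + 1) - 1)) ((Finset.range Q).image fun q => gridVertex Q W (q + 1) W),
        ?_, ?_⟩
      · refine (Finset.card_insert_le _ _).trans ?_
        have := (Finset.range Q).card_image_le (f := fun q => gridVertex Q W (q + 1) W)
        rw [Finset.card_range] at this
        omega
      · intro v w huv hvw
        have hv : ¬ ((v : ℕ) % (W + 1) = W ∧ 0 < (v : ℕ) / (W + 1)) := by
          rcases hreach u v huv with rfl | h
          · exact hu
          · omega
        have hwQ : (w : ℕ) / (W + 1) < Q + 1 :=
          (Nat.div_lt_iff_lt_mul (Nat.succ_pos _)).2 w.2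
        rcases hvw with ⟨h1, h2, h3, h4, h5, h6⟩ | ⟨h1, h2, h3, h4⟩ | ⟨h1, h2, h3, h4⟩
        -- All of `u`, `v`, `w` are slots of one pair and `v ≠ w`, so `u` is one of these two:
        -- either `w` is the partner of `u`, or `w` is `u` itself.
        · have hc : (u : ℕ) % (W + 1) = (v : ℕ) % (W + 1) ∧ (u : ℕ) / (W + 1) = 0 ∨
              (u : ℕ) % (W + 1) = (w : ℕ) % (W + 1) ∧ (u : ℕ) / (W + 1) = 0 := by
            rcases hreach u v huv with rfl | h
            · exact Or.inl ⟨rfl, h1⟩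
            · omega
          rcases hc with ⟨hc, hc'⟩ | ⟨hc, hc'⟩
          · refine Or.inr ⟨_, Finset.mem_insert_self _ _, ?_⟩
            rw [eq_gridVertex h2 rfl]
            convert SimpleGraph.Reachable.refl _ using 2
            split_ifs <;> omega
          · refine Or.inl ?_
            rw [eq_gridVertex h2 rfl, eq_gridVertex hc' rfl, hc]
        · refine Or.inr ⟨w, ?_, SimpleGraph.Reachable.refl _⟩
          refine Finset.mem_insert_of_mem (Finset.mem_image.2 ⟨(w : ℕ) / (W + 1) - 1, ?_, ?_⟩)
          · rw [Finset.mem_range]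
            omega
          · exact (eq_gridVertex (by omega) h2).symm
        · exact absurd ⟨h2, h3⟩ hv

/-- A counting argument with no slack. The constraints `grp i t` with `t ≤ 2 * k` are `2 * k + 1`
distinct ones that accept pairs of group `i` only, one more than the vertices that `k` edges can
touch. They force two touched slots in each group, which uses up all touched vertices. -/
theorem selection_of_maximumDegreeContraction (hW : W = 2 * (k * A)) (hA : 0 < A) (hk : 0 < k)
    (grp : ℕ → ℕ → ℕ) (hinj : ∀ i, Function.Injective (grp i))
    (hgrp : ∀ i < k, ∀ t ≤ 2 * k, grp i t < Q ∧ ∀ p, sat (grp i t) p → p / A = i)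
    (h : MaximumDegreeContraction (selectionGraph Q W sat) k (W - 1)) :
    ∃ p : Fin k → ℕ, (∀ i, p i / A = i) ∧ ∀ q < Q, ∃ i, sat q (p i) := by
  classical
  obtain ⟨F, hFG, hFk, hd⟩ := h
  have hWpos : 0 < W := by
    rw [hW]
    positivity
  set H := SimpleGraph.fromEdgeSet (F : Set (Sym2 (Fin ((Q + 1) * (W + 1))))) with hH
  have hHG : ∀ u v, H.Adj u v → (selectionGraph Q W sat).Adj u v := fun u v huv => by
    rw [hH, SimpleGraph.fromEdgeSet_adj] at huv
    exact hFG huv.1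
  set touched : Finset (Fin ((Q + 1) * (W + 1))) :=
    Finset.univ.filter fun u => ∃ v, H.Adj u v with htouched
  have hcard : touched.card ≤ 2 * k := by
    have hsub : touched ⊆ F.biUnion fun e => e.toFinset := by
      intro u hu
      obtain ⟨v, hv⟩ := (Finset.mem_filter.1 hu).2
      rw [hH, SimpleGraph.fromEdgeSet_adj] at hv
      exact Finset.mem_biUnion.2 ⟨_, hv.1, by simp⟩
    refine (Finset.card_le_card hsub).trans (Finset.card_biUnion_le.trans ?_)
    refine (Finset.sum_le_card_nsmul _ _ 2 fun e _ => ?_).trans ?_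
    · rw [Sym2.card_toFinset]
      split_ifs <;> omega
    · rw [smul_eq_mul]
      omega
  have hnot : ∀ {u}, u ∉ touched → ∀ w, ¬ H.Adj u w := fun hu w hw =>
    hu (Finset.mem_filter.2 ⟨Finset.mem_univ _, w, hw⟩)
  -- Some two neighbors of an untouched constraint vertex are merged. Neither is a private leaf: the
  -- only neighbor of such a leaf is the constraint vertex, so it could not be touched.
  have hred : ∀ q < Q, gridVertex Q W (q + 1) W ∉ touched → ∃ s s', s < W ∧ s' < W ∧ s ≠ s' ∧
      sat q (s / 2) ∧ sat q (s' / 2) ∧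
      H.Reachable (gridVertex Q W 0 s) (gridVertex Q W 0 s') := by
    intro q hq hqt
    obtain ⟨s, s', hne, hr⟩ := SimpleGraph.exists_reachable_of_ncard_lt (W := W)
      (selectionGraph Q W sat) F _ (hnot hqt) (fun s => gridVertex Q W (linkRow sat q s) s)
      (fun s => selectionGraph_adj_link hq s.2) ((hd _).trans_lt (by omega))
    have hmain : ∀ s s' : Fin W, s ≠ s' → H.Reachable (gridVertex Q W (linkRow sat q s) s)
        (gridVertex Q W (linkRow sat q s') s') → sat q (s / 2) := by
      intro s s' hne hr
      by_contra hsat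
      have hrow : linkRow sat q s = q + 1 := if_neg hsat
      obtain ⟨w, hw⟩ := hr.exists_adj_of_ne (fun he => hne (Fin.ext (by
        rw [← gridVertex_mod (Q := Q) (r := linkRow sat q s) s.2.le, he,
          gridVertex_mod s'.2.le])))
      have hw' := hHG _ _ hw
      rw [hrow] at hw'
      have hs2 := s.2
      rcases hw' with ⟨h1, _⟩ | ⟨h1, h2, h3, h4⟩ | ⟨h1, h2, h3, h4⟩
      · rw [gridVertex_div (by omega)] at h1
        omega
      · rw [gridVertex_div (by omega), gridVertex_mod hs2.le] at h4
        refine hnot hqt _ ((?_ : w = gridVertex Q W (q + 1) W) ▸ hw.symm)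
        refine eq_gridVertex ?_ h2
        rcases h4 with h4 | h4
        · omega
        · exact h4.2.symm
      · rw [gridVertex_mod hs2.le] at h2
        omega
    have hs := hmain s s' hne hr
    have hs' := hmain s' s hne.symm hr.symm
    rw [linkRow, linkRow, if_pos hs, if_pos hs'] at hr
    exact ⟨s, s', s.2, s'.2, fun h => hne (Fin.ext h), hs, hs', hr⟩
  have hgroup : ∀ i : Fin k, ∃ s s', s < W ∧ s' < W ∧ s ≠ s' ∧ s / 2 / A = i ∧ s' / 2 / A = i ∧
      H.Reachable (gridVertex Q W 0 s) (gridVertex Q W 0 s') := by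
    intro i
    -- Pigeonhole: `2 * k + 1` constraint vertices, at most `2 * k` touched vertices.
    obtain ⟨t, ht, hti⟩ : ∃ t ≤ 2 * k, gridVertex Q W (grp i t + 1) W ∉ touched := by
      by_contra! hc
      have hle := Finset.card_le_card_of_injOn (s := Finset.range (2 * k + 1)) (t := touched)
        (fun t => gridVertex Q W (grp i t + 1) W)
        (fun t ht => hc t (by simpa [Nat.lt_succ_iff] using ht))
        (fun t ht t' ht' he => by
          have h1 := (hgrp i i.2 t (by simpa [Nat.lt_succ_iff] using ht)).1
          have h2 := (hgrp i i.2 t' (by simpa [Nat.lt_succ_iff] using ht')).1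
          have h3 := gridVertex_div (Q := Q) (W := W) (r := grp i t + 1) (s := W) (by omega)
          simp only at he
          rw [he, gridVertex_div (by omega)] at h3
          exact hinj i (by omega))
      rw [Finset.card_range] at hle
      omega
    obtain ⟨h1, h2⟩ := hgrp i i.2 t ht
    obtain ⟨s, s', hs, hs', hne, h3, h4, hr⟩ := hred _ h1 hti
    exact ⟨s, s', hs, hs', hne, h2 _ h3, h2 _ h4, hr⟩
  choose s s' hs hs' hne hi hi' hr using hgroup
  -- The slots `s i`, `s' i` are touched and pairwise distinct, as different groups occupy different
  -- columns. There are `2 * k` of them, so no other vertex is touched.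
  have htouch : touched = (Finset.univ : Finset (Fin k × Bool)).image
      fun x => gridVertex Q W 0 (if x.2 then s x.1 else s' x.1) := by
    symm
    refine Finset.eq_of_subset_of_card_le ?_ ?_
    · rintro _ hv
      obtain ⟨⟨i, b⟩, -, rfl⟩ := Finset.mem_image.1 hv
      have hne' : gridVertex Q W 0 (s i) ≠ gridVertex Q W 0 (s' i) := fun he => hne i (by
        rw [← gridVertex_mod (Q := Q) (r := 0) (hs i).le, he, gridVertex_mod (hs' i).le])
      refine Finset.mem_filter.2 ⟨Finset.mem_univ _, ?_⟩
      cases b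
      · exact (hr i).symm.exists_adj_of_ne hne'.symm
      · exact (hr i).exists_adj_of_ne hne'
    · rw [Finset.card_image_of_injective]
      · simpa [mul_comm] using hcard
      · rintro ⟨i, b⟩ ⟨i', b'⟩ he
        have hx : (if b then s i else s' i) = if b' then s i' else s' i' := by
          have h1 : (if b then s i else s' i) ≤ W := by
            have := hs i
            have := hs' i
            split_ifs <;> omega
          have h2 : (if b' then s i' else s' i') ≤ W := by
            have := hs i'
            have := hs' i'
            split_ifs <;> omega
          simp only at he
          rw [← gridVertex_mod (Q := Q) (r := 0) h1, he, gridVertex_mod h2]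
        have hii : i = i' := by
          have h1 : (if b then s i else s' i) / 2 / A = i := by
            split_ifs
            exacts [hi i, hi' i]
          have h2 : (if b' then s i' else s' i') / 2 / A = i' := by
            split_ifs
            exacts [hi i', hi' i']
          exact Fin.ext (by rw [← h1, hx, h2])
        subst hii
        have := hne i
        cases b <;> cases b'
        · rfl
        · exact absurd hx.symm this
        · exact absurd hx this
        · rfl
  have htrow : ∀ u ∈ touched, (u : ℕ) / (W + 1) = 0 ∧ ∃ i, (u : ℕ) % (W + 1) = s i ∨
      (u : ℕ) % (W + 1) = s' i := by
    intro u hu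
    rw [htouch] at hu
    obtain ⟨⟨i, b⟩, -, rfl⟩ := Finset.mem_image.1 hu
    have := hs i
    have := hs' i
    refine ⟨gridVertex_div (by omega), i, ?_⟩
    cases b
    · exact Or.inr (gridVertex_mod (by simpa using (hs' i).le))
    · exact Or.inl (gridVertex_mod (by simpa using (hs i).le))
  -- Both ends of a contracted edge lie in row `0`, so the edge joins the two slots of a pair;
  -- components do not leave their pair.
  have hpair : ∀ u v, H.Reachable u v →
      (u : ℕ) % (W + 1) / 2 = (v : ℕ) % (W + 1) / 2 := by
    intro u v huv
    refine SimpleGraph.Reachable.rel (r := fun u v : Fin ((Q + 1) * (W + 1)) =>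
      (u : ℕ) % (W + 1) / 2 = (v : ℕ) % (W + 1) / 2)
      ⟨fun _ => rfl, fun h => h.symm, fun h h' => h.trans h'⟩ ?_ huv
    intro u v h
    have hu := (htrow u (Finset.mem_filter.2 ⟨Finset.mem_univ _, v, h⟩)).1
    have hv := (htrow v (Finset.mem_filter.2 ⟨Finset.mem_univ _, u, h.symm⟩)).1
    rcases hHG u v h with ⟨_, _, _, _, h5, _⟩ | ⟨_, _, h3, _⟩ | ⟨_, _, h3, _⟩
    · exact h5
    · omega
    · omega
  have hss : ∀ i, s i / 2 = s' i / 2 := fun i => by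
    have := hpair _ _ (hr i)
    rwa [gridVertex_mod (hs i).le, gridVertex_mod (hs' i).le] at this
  refine ⟨fun i => s i / 2, hi, fun q hq => ?_⟩
  -- Constraint vertices lie outside row `0`, so now all of them are known to be untouched.
  obtain ⟨x, x', hx, hx', hxx, h1, h2, hxr⟩ := hred q hq (fun hmem => by
    have := (htrow _ hmem).1
    rw [gridVertex_div (by omega)] at this
    omega)
  have hxne : gridVertex Q W 0 x ≠ gridVertex Q W 0 x' := fun he => hxx (by
    rw [← gridVertex_mod (Q := Q) (r := 0) hx.le, he, gridVertex_mod hx'.le])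
  obtain ⟨i, hx2⟩ := (htrow _ (Finset.mem_filter.2 ⟨Finset.mem_univ _,
    hxr.exists_adj_of_ne hxne⟩)).2
  rw [gridVertex_mod hx.le] at hx2
  refine ⟨i, ?_⟩
  rcases hx2 with rfl | rfl
  · exact h1
  · simpa only [hss] using h1

end SelectionGraph

/-! ### From formulas to selection graphs -/

theorem List.getD_flatMap_of_length_eq {α β : Type*} (f : α → List β) {c : ℕ}
    (hf : ∀ a, (f a).length = c) (l : List α) (d : β) (i : ℕ) (hi : i < l.length) (r : ℕ)
    (hr : r < c) : (l.flatMap f).getD (i * c + r) d = (f l[i]).getD r d := by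
  induction l generalizing i with
  | nil => simp at hi
  | cons a l ih =>
    rw [List.flatMap_cons]
    cases i with
    | zero =>
      rw [zero_mul, zero_add, List.getD_append _ _ _ _ (by rwa [hf])]
      rfl
    | succ i =>
      rw [List.getD_append_right _ _ _ _ (by rw [hf, add_mul]; omega), hf]
      have : (i + 1) * c + r - c = i * c + r := by rw [add_mul]; omega
      rw [this, ih i (by simpa using hi)]
      rfl

theorem List.length_flatMap_of_length_eq {α β : Type*} (f : α → List β) {c : ℕ}
    (hf : ∀ a, (f a).length = c) (l : List α) : (l.flatMap f).length = l.length * c := by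
  induction l with
  | nil => simp
  | cons a l ih => rw [List.flatMap_cons, List.length_append, ih, hf, List.length_cons]; ring

namespace ThreeCNF

variable (φ : ThreeCNF)

theorem length_encode : φ.encode.length = 2 + 6 * φ.clauses.length := by
  rw [encode, List.length_cons, List.length_cons, List.length_flatMap_of_length_eq _ (c := 6)
    (fun C => by simp [List.finRange])]
  ring

theorem encode_getD (q : ℕ) (hq : q < φ.clauses.length) (r : ℕ) (hr : r < 6) :
    φ.encode.getD (2 + 6 * q + r) 0 = ((List.finRange 3).flatMap fun i =>
      [((φ.clauses[q] i).1 : ℕ), if (φ.clauses[q] i).2 then 1 else 0]).getD r 0 := by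
  rw [encode, show 2 + 6 * q + r = (q * 6 + r) + 1 + 1 by ring, List.getD_cons_succ,
    List.getD_cons_succ, List.getD_flatMap_of_length_eq _ (c := 6) _ _ _ _ hq _ hr]
  intro C
  simp [List.finRange]

theorem encode_var (q : ℕ) (hq : q < φ.clauses.length) (j : Fin 3) :
    φ.encode.getD (2 + 6 * q + 2 * j) 0 = (φ.clauses[q] j).1 := by
  rw [encode_getD φ q hq _ (by omega)]
  fin_cases j <;> simp [List.finRange]

theorem encode_sign (q : ℕ) (hq : q < φ.clauses.length) (j : Fin 3) :
    φ.encode.getD (2 + 6 * q + 2 * j + 1) 0 = if (φ.clauses[q] j).2 then 1 else 0 := by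
  rw [add_assoc (2 + 6 * q), encode_getD φ q hq _ (by omega)]
  fin_cases j <;> simp [List.finRange]

theorem encode_getD_le (a : ℕ) : φ.encode.getD a 0 ≤ φ.numVars + φ.clauses.length + 1 := by
  have h : ∀ x ∈ φ.encode, x ≤ φ.numVars + φ.clauses.length + 1 := by
    intro x hx
    simp only [encode, List.mem_cons, List.mem_flatMap, List.not_mem_nil, or_false] at hx
    rcases hx with rfl | rfl | ⟨C, _, i, _, rfl | rfl⟩
    · omega
    · omega
    · have := (C i).1.2
      omega
    · split_ifs <;> omega
  by_cases ha : a < φ.encode.length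
  · rw [List.getD_eq_getElem _ _ ha]
    exact h _ (List.getElem_mem _)
  · rw [List.getD_eq_default _ _ (by omega)]
    omega

end ThreeCNF

/-- The literal `j` of the clause `q` is made true by the partial assignment `p % A` of the group
`p / A`, where each group has `L` variables and `x` is the code of a formula. -/
def LiteralHolds (L A : ℕ) (x : ℕ → ℕ) (q p j : ℕ) : Prop :=
  x (2 + 6 * q + 2 * j) / L = p / A ∧
    p % A / 2 ^ (x (2 + 6 * q + 2 * j) % L) % 2 = x (2 + 6 * q + 2 * j + 1)

/-- The pair `p` satisfies the constraint `q`: the constraints `q < m` are the clauses, and the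
other ones ask for a pair in a specific group. -/
def PairSat (k m L A : ℕ) (x : ℕ → ℕ) (q p : ℕ) : Prop :=
  (q < m ∧ (LiteralHolds L A x q p 0 ∨ LiteralHolds L A x q p 1 ∨ LiteralHolds L A x q p 2)) ∨
    (¬ q < m ∧ (q - m) % k = p / A)

namespace ThreeCNF

variable (φ : ThreeCNF) (k : ℕ)

/-- The size of the groups of variables. -/
def groupSize : ℕ := φ.numVars / k + 1

/-- The number of constraints. -/
def numConstraints : ℕ := φ.clauses.length + k * (2 * k + 1)

/-- The number of pairs in each group. -/
def groupPairs : ℕ := 2 ^ φ.groupSize k * (φ.numConstraints k + 2)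

/-- The number of pair vertices. -/
def numSlots : ℕ := 2 * (k * φ.groupPairs k)

/-- The number of vertices. -/
def numVertices : ℕ := (φ.numConstraints k + 1) * (φ.numSlots k + 1)

/-- Satisfaction of constraints by pairs. -/
def pairSat : ℕ → ℕ → Prop :=
  PairSat k φ.clauses.length (φ.groupSize k) (φ.groupPairs k) (fun i => φ.encode.getD i 0)

/-- The graph of the reduction. -/
def contractionGraph : SimpleGraph (Fin (φ.numVertices k)) :=
  selectionGraph (φ.numConstraints k) (φ.numSlots k) (φ.pairSat k)

variable {k}

theorem groupPairs_pos : 0 < φ.groupPairs k := by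
  unfold groupPairs
  positivity

theorem var_div_lt (hk : 0 < k) (v : Fin φ.numVars) : (v : ℕ) / φ.groupSize k < k := by
  rw [Nat.div_lt_iff_lt_mul (show 0 < φ.groupSize k from Nat.succ_pos _)]
  exact v.2.trans (Nat.lt_mul_div_succ _ hk)

theorem literalHolds_iff {L A q p : ℕ} (hq : q < φ.clauses.length) (j : Fin 3) :
    LiteralHolds L A (fun i => φ.encode.getD i 0) q p j ↔
      ((φ.clauses[q] j).1 : ℕ) / L = p / A ∧
        (p % A).testBit ((φ.clauses[q] j).1 % L) = (φ.clauses[q] j).2 := by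
  rw [LiteralHolds, encode_var φ q hq, encode_sign φ q hq, Nat.testBit_eq_decide_div_mod_eq]
  refine and_congr_right fun _ => ?_
  generalize p % A / 2 ^ (((φ.clauses[q] j).1 : ℕ) % L) = z
  rcases Nat.mod_two_eq_zero_or_one z with h | h <;> cases (φ.clauses[q] j).2 <;> simp [h]

theorem pairSat_of_lt {q p : ℕ} (hq : q < φ.clauses.length) :
    φ.pairSat k q p ↔ ∃ j : Fin 3,
      ((φ.clauses[q] j).1 : ℕ) / φ.groupSize k = p / φ.groupPairs k ∧
        (p % φ.groupPairs k).testBit ((φ.clauses[q] j).1 % φ.groupSize k) =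
          (φ.clauses[q] j).2 := by
  simp only [← literalHolds_iff φ hq]
  rw [pairSat, PairSat]
  simp [hq, Fin.exists_fin_succ]

theorem pairSat_of_not_lt {q p : ℕ} (hq : ¬ q < φ.clauses.length) :
    φ.pairSat k q p ↔ (q - φ.clauses.length) % k = p / φ.groupPairs k := by
  rw [pairSat, PairSat]
  simp [hq]

/-- The chosen pair of group `i` stores the values of the variables `v` with `v / groupSize = i` in
the bits `v % groupSize` of its position in the group. Each literal depends on one variable, so a
clause is satisfied iff a single chosen pair satisfies it. -/
theorem satisfiable_iff_selection (hk : 0 < k) : φ.Satisfiable ↔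
    ∃ p : Fin k → ℕ, (∀ i, p i / φ.groupPairs k = i) ∧
      ∀ q < φ.numConstraints k, ∃ i, φ.pairSat k q (p i) := by
  have hA := φ.groupPairs_pos (k := k)
  constructor
  · rintro ⟨α, hα⟩
    -- The groups have room for more than `numVars` variables; the surplus bits are `false`.
    set a : Fin k → ℕ := fun i => Nat.ofBits fun j : Fin (φ.groupSize k) =>
      if h : i * φ.groupSize k + j < φ.numVars then α ⟨_, h⟩ else false with ha
    have haA : ∀ i, a i < φ.groupPairs k := fun i =>
      (Nat.ofBits_lt_two_pow _).trans_le (Nat.le_mul_of_pos_right _ (by omega))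
    have hdiv : ∀ i, (i * φ.groupPairs k + a i) / φ.groupPairs k = i := fun i => by
      rw [mul_comm, Nat.mul_add_div hA, Nat.div_eq_of_lt (haA i), add_zero]
    have hmod : ∀ i, (i * φ.groupPairs k + a i) % φ.groupPairs k = a i := fun i => by
      rw [mul_comm, Nat.mul_add_mod, Nat.mod_eq_of_lt (haA i)]
    refine ⟨fun i => i * φ.groupPairs k + a i, hdiv, fun q _ => ?_⟩
    by_cases hqm : q < φ.clauses.length
    · obtain ⟨j, hj⟩ := hα _ (List.getElem_mem hqm)
      refine ⟨⟨_, φ.var_div_lt hk (φ.clauses[q] j).1⟩, ?_⟩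
      rw [pairSat_of_lt φ hqm]
      refine ⟨j, (hdiv ⟨_, φ.var_div_lt hk (φ.clauses[q] j).1⟩).symm, ?_⟩
      rw [hmod, ← hj]
      refine (Nat.testBit_ofBits_lt _ _
        (Nat.mod_lt _ (Nat.succ_pos _) : _ < φ.groupSize k)).trans ?_
      simp only [Nat.div_add_mod', Fin.is_lt, dif_pos]
    · refine ⟨⟨_, Nat.mod_lt (q - φ.clauses.length) hk⟩, ?_⟩
      rw [pairSat_of_not_lt φ hqm, hdiv]
  · rintro ⟨p, hp, h⟩
    refine ⟨fun v => (p ⟨_, φ.var_div_lt hk v⟩ % φ.groupPairs k).testBit (v % φ.groupSize k),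
      fun C hC => ?_⟩
    obtain ⟨q, hq, rfl⟩ := List.getElem_of_mem hC
    obtain ⟨i, hi⟩ := h q (hq.trans_le (Nat.le_add_right _ _))
    obtain ⟨j, hj, hj'⟩ := (pairSat_of_lt φ hq).1 hi
    refine ⟨j, ?_⟩
    rw [hp] at hj
    simp only [hj, hj']

/-- This is the purpose of the factor `numConstraints + 2` in `groupPairs`: it pads each group with
pairs repeating the same assignments, so that slots outnumber constraints and only constraint
vertices violate the degree bound. -/
theorem numConstraints_add_two_le (hk : 0 < k) : φ.numConstraints k + 2 ≤ φ.numSlots k := by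
  have h1 : φ.numConstraints k + 2 ≤ φ.groupPairs k :=
    Nat.le_mul_of_pos_left _ (by positivity)
  have h2 : φ.groupPairs k ≤ k * φ.groupPairs k := Nat.le_mul_of_pos_left _ hk
  unfold numSlots
  omega

theorem maximumDegreeContraction_iff (hk : 0 < k) :
    MaximumDegreeContraction (φ.contractionGraph k) k (φ.numSlots k - 1) ↔ φ.Satisfiable := by
  rw [satisfiable_iff_selection φ hk]
  constructor
  · refine selection_of_maximumDegreeContraction rfl φ.groupPairs_pos hk
      -- The constraints after the clauses ask for the group given by their index modulo `k`; these
      -- are the `2 * k + 1` copies for group `i`.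
      (fun i t => φ.clauses.length + (i + k * t)) (fun i t t' h => ?_) (fun i hi t ht => ⟨?_, ?_⟩)
    · exact Nat.eq_of_mul_eq_mul_left hk (by simp only at h; omega)
    · have h1 := Nat.mul_le_mul_left k ht
      rw [numConstraints, mul_add]
      omega
    · intro p hp
      rw [pairSat_of_not_lt φ (by omega), Nat.add_sub_cancel_left, Nat.add_mul_mod_self_left,
        Nat.mod_eq_of_lt hi] at hp
      exact hp.symm
  · rintro ⟨p, hp, hs⟩
    exact maximumDegreeContraction_of_selection rfl φ.groupPairs_pos
      (φ.numConstraints_add_two_le hk) p hp hs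

/-! ### All parameters are bounded by the number of vertices -/

theorem numConstraints_lt_numVertices : φ.numConstraints k < φ.numVertices k := by
  unfold numVertices
  rw [mul_add]
  omega

theorem numSlots_lt_numVertices : φ.numSlots k < φ.numVertices k := by
  unfold numVertices
  rw [add_mul]
  omega

theorem groupPairs_le_numVertices (hk : 0 < k) : φ.groupPairs k ≤ φ.numVertices k := by
  have h1 := φ.numSlots_lt_numVertices (k := k)
  have h2 : φ.groupPairs k ≤ k * φ.groupPairs k := Nat.le_mul_of_pos_left _ hk
  unfold numSlots at h1
  omega

theorem groupSize_le_numVertices (hk : 0 < k) : φ.groupSize k ≤ φ.numVertices k :=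
  Nat.lt_two_pow_self.le.trans ((Nat.le_mul_of_pos_right _ (by omega)).trans
    (φ.groupPairs_le_numVertices hk))

theorem two_pow_le_numVertices (hk : 0 < k) : 2 ^ φ.groupSize k ≤ φ.numVertices k :=
  (Nat.le_mul_of_pos_right _ (by omega)).trans (φ.groupPairs_le_numVertices hk)

theorem le_numVertices : k ≤ φ.numVertices k := by
  have h1 := φ.numConstraints_lt_numVertices (k := k)
  unfold numConstraints at h1
  rw [mul_add] at h1
  omega

theorem clauses_le_numVertices (hk : 0 < k) : 2 + 6 * φ.clauses.length ≤ φ.numVertices k := by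
  have h1 := φ.numConstraints_add_two_le hk
  have h2 : φ.clauses.length + 3 ≤ φ.numConstraints k := by
    have : 1 * 3 ≤ k * (2 * k + 1) := Nat.mul_le_mul hk (by omega)
    unfold numConstraints
    omega
  have h3 : 4 * (φ.numSlots k + 1) ≤ φ.numVertices k := Nat.mul_le_mul_right _ (by omega)
  have h4 : (φ.numConstraints k + 1) * 6 ≤ φ.numVertices k := Nat.mul_le_mul_left _ (by omega)
  omega

theorem numVars_le_numVertices (hk : 0 < k) : φ.numVars ≤ φ.numVertices k := by
  have h1 : φ.numVars < k * φ.groupSize k := Nat.lt_mul_div_succ _ hk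
  have h2 : k * φ.groupSize k ≤ k * φ.groupPairs k := Nat.mul_le_mul_left _
    (Nat.lt_two_pow_self.le.trans (Nat.le_mul_of_pos_right _ (by omega)))
  have h3 := φ.numSlots_lt_numVertices (k := k)
  unfold numSlots at h3
  omega

end ThreeCNF

/-! ### Entries of the encoded instance -/

open Classical in
theorem encodeMDC_getD {n : ℕ} (G : SimpleGraph (Fin n)) (k d t : ℕ) :
    (encodeMDC G k d).getD (t + 3) 0 =
      if ∃ u v : Fin n, t = u * n + v ∧ G.Adj u v then 1 else 0 := by
  rw [encodeMDC, List.getD_cons_succ, List.getD_cons_succ, List.getD_cons_succ]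
  by_cases ht : t < n * n
  · have hn : 0 < n := Nat.pos_of_ne_zero (by rintro rfl; simp at ht)
    have h1 : t / n < n := (Nat.div_lt_iff_lt_mul hn).2 ht
    have h2 : t % n < n := Nat.mod_lt _ hn
    have h := List.getD_flatMap_of_length_eq (c := n)
      (fun u : Fin n => (List.finRange n).map fun v => if G.Adj u v then 1 else 0)
      (fun u => by simp) (List.finRange n) 0 (t / n) (by simpa) (t % n) h2
    rw [Nat.div_add_mod'] at h
    rw [h, List.getD_eq_getElem _ _ (by simpa)]
    simp only [List.getElem_map, List.getElem_finRange]
    refine if_congr ⟨fun h => ⟨_, _, (Nat.div_add_mod' t n).symm, h⟩, ?_⟩ rfl rfl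
    rintro ⟨u, v, rfl, hG⟩
    have e1 : (u * n + v : ℕ) / n = u := by
      rw [mul_comm (u : ℕ), Nat.mul_add_div hn, Nat.div_eq_of_lt v.2, add_zero]
    have e2 : (u * n + v : ℕ) % n = v := by
      rw [mul_comm (u : ℕ), Nat.mul_add_mod, Nat.mod_eq_of_lt v.2]
    simpa [e1, e2] using hG
  · rw [List.getD_eq_default, if_neg]
    · rintro ⟨u, v, rfl, _⟩
      have h3 : (u : ℕ) + 1 ≤ n := u.2
      have h1 := Nat.mul_le_mul_right n h3
      have h2 := v.2
      rw [add_mul] at h1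
      omega
    · rw [List.length_flatMap_of_length_eq _ (c := n) (fun u => by simp)]
      simpa using ht

open Classical in
theorem encodeMDC_contractionGraph_getD (φ : ThreeCNF) (k d t : ℕ)
    (ht : t < φ.numVertices k * φ.numVertices k) :
    (encodeMDC (φ.contractionGraph k) k d).getD (t + 3) 0 =
      if SelectionAdj (φ.numSlots k) (φ.pairSat k)
        (t / φ.numVertices k / (φ.numSlots k + 1)) (t / φ.numVertices k % (φ.numSlots k + 1))
        (t % φ.numVertices k / (φ.numSlots k + 1)) (t % φ.numVertices k % (φ.numSlots k + 1))
      then 1 else 0 := by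
  rw [encodeMDC_getD]
  have hn : 0 < φ.numVertices k := Nat.pos_of_ne_zero (by intro h; simp [h] at ht)
  refine if_congr ⟨?_, fun h => ?_⟩ rfl rfl
  · rintro ⟨u, v, rfl, h⟩
    rw [mul_comm (u : ℕ), Nat.mul_add_div hn, Nat.div_eq_of_lt v.2, Nat.mul_add_mod,
      Nat.mod_eq_of_lt v.2]
    exact h
  · exact ⟨⟨_, (Nat.div_lt_iff_lt_mul hn).2 ht⟩, ⟨_, Nat.mod_lt _ hn⟩,
      (Nat.div_add_mod' _ _).symm, h⟩

/-! ### Boolean expressions -/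

namespace ArithExpr

variable {reg mem : ℕ → ℕ} {a b : ArithExpr} {p q : Prop}

/-- The value of the expression is the truth value of `p`. -/
def Tests (reg mem : ℕ → ℕ) (a : ArithExpr) (p : Prop) : Prop :=
  (p ∧ a.eval reg mem = 1) ∨ (¬ p ∧ a.eval reg mem = 0)

/-- Negation. -/
def not (a : ArithExpr) : ArithExpr := bin .sub (lit 1) a

/-- Conjunction. -/
def and (a b : ArithExpr) : ArithExpr := bin .mul a b

/-- Disjunction. -/
def or (a b : ArithExpr) : ArithExpr := not (and (not a) (not b))

/-- Equality. -/
def eq (a b : ArithExpr) : ArithExpr := not (bin .add (bin .sub a b) (bin .sub b a))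

/-- The strict order. -/
def lt (a b : ArithExpr) : ArithExpr := not (not (bin .sub b a))

theorem Tests.not (h : Tests reg mem a p) : Tests reg mem a.not (¬ p) := by
  rcases h with ⟨h, h'⟩ | ⟨h, h'⟩ <;> simp [Tests, ArithExpr.not, eval, ArithOp.eval, h, h']

theorem Tests.and (h : Tests reg mem a p) (h' : Tests reg mem b q) :
    Tests reg mem (a.and b) (p ∧ q) := by
  rcases h with ⟨h1, h2⟩ | ⟨h1, h2⟩ <;> rcases h' with ⟨h3, h4⟩ | ⟨h3, h4⟩ <;>
  simp [Tests, ArithExpr.and, eval, ArithOp.eval, h1, h2, h3, h4]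

theorem Tests.or (h : Tests reg mem a p) (h' : Tests reg mem b q) :
    Tests reg mem (a.or b) (p ∨ q) := by
  have := (h.not.and h'.not).not
  rwa [← not_or, not_not] at this

theorem tests_eq (a b : ArithExpr) :
    Tests reg mem (a.eq b) (a.eval reg mem = b.eval reg mem) := by
  simp only [Tests, ArithExpr.eq, ArithExpr.not, eval, ArithOp.eval]
  omega

theorem tests_lt (a b : ArithExpr) :
    Tests reg mem (a.lt b) (a.eval reg mem < b.eval reg mem) := by
  simp only [Tests, ArithExpr.lt, ArithExpr.not, eval, ArithOp.eval]
  omega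

open Classical in
theorem Tests.eval_eq (h : Tests reg mem a p) : a.eval reg mem = if p then 1 else 0 := by
  rcases h with ⟨h, h'⟩ | ⟨h, h'⟩ <;> simp [h, h']

theorem Tests.congr (h : Tests reg mem a p) (hpq : p ↔ q) : Tests reg mem a q := by
  rwa [propext hpq] at h

/-! ### The adjacency test

Register `3` holds the address of a copy of the formula, and the registers `4, …, 9` hold the number
of vertices, `k`, the number of clauses, the size of the groups, the number of pairs in each group,
and the number of slots. -/

/-- The address of the variable of a literal. -/
def literalAddr (q : ArithExpr) (j : ℕ) : ArithExpr :=
  bin .add (var 3) (bin .add (bin .add (lit 2) (bin .mul (lit 6) q)) (lit (2 * j)))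

/-- A test for `LiteralHolds`. -/
def literalTest (q p : ArithExpr) (j : ℕ) : ArithExpr :=
  and (eq (bin .div (ld (literalAddr q j)) (var 7)) (bin .div p (var 8)))
    (eq (bin .mod (bin .shr (bin .mod p (var 8)) (bin .mod (ld (literalAddr q j)) (var 7))) (lit 2))
      (ld (bin .add (literalAddr q j) (lit 1))))

/-- A test for `PairSat`. -/
def pairSatTest (q p : ArithExpr) : ArithExpr :=
  or (and (lt q (var 6)) (or (literalTest q p 0) (or (literalTest q p 1) (literalTest q p 2))))
    (and (not (lt q (var 6))) (eq (bin .mod (bin .sub q (var 6)) (var 5)) (bin .div p (var 8))))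

/-- A test for `SelectionLink`. -/
def linkTest (r s r' s' : ArithExpr) : ArithExpr :=
  and (lt s (var 9)) (and (eq s' (var 9)) (and (lt (lit 0) r')
    (or (and (pairSatTest (bin .sub r' (lit 1)) (bin .div s (lit 2))) (eq r (lit 0)))
      (and (not (pairSatTest (bin .sub r' (lit 1)) (bin .div s (lit 2)))) (eq r r')))))

/-- A test for `SelectionAdj`. -/
def adjTest (r s r' s' : ArithExpr) : ArithExpr :=
  or (and (eq r (lit 0)) (and (eq r' (lit 0)) (and (lt s (var 9)) (and (lt s' (var 9))
    (and (eq (bin .div s (lit 2)) (bin .div s' (lit 2))) (not (eq s s')))))))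
    (or (linkTest r s r' s') (linkTest r' s' r s))

/-- The row of vertex `u`. -/
def rowOf (u : ArithExpr) : ArithExpr := bin .div u (bin .add (var 9) (lit 1))

/-- The column of vertex `u`. -/
def colOf (u : ArithExpr) : ArithExpr := bin .mod u (bin .add (var 9) (lit 1))

/-- The entry of the code of the instance at the position in register `0`. -/
def instanceEntry : ArithExpr :=
  bin .add (bin .add (bin .mul (eq (var 0) (lit 0)) (var 4)) (bin .mul (eq (var 0) (lit 1)) (var 5)))
    (bin .add (bin .mul (eq (var 0) (lit 2)) (bin .sub (var 9) (lit 1)))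
      (bin .mul (lt (lit 2) (var 0))
        (adjTest (rowOf (bin .div (bin .sub (var 0) (lit 3)) (var 4)))
          (colOf (bin .div (bin .sub (var 0) (lit 3)) (var 4)))
          (rowOf (bin .mod (bin .sub (var 0) (lit 3)) (var 4)))
          (colOf (bin .mod (bin .sub (var 0) (lit 3)) (var 4))))))

theorem literalTest_tests (q p : ArithExpr) (j : ℕ) (x : ℕ → ℕ)
    (hx : ∀ i < 6, mem (reg 3 + (2 + 6 * q.eval reg mem + i)) = x (2 + 6 * q.eval reg mem + i))
    (hj : j < 3) : Tests reg mem (literalTest q p j)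
      (LiteralHolds (reg 7) (reg 8) x (q.eval reg mem) (p.eval reg mem) j) := by
  have h1 := hx (2 * j) (by omega)
  have h2 := hx (2 * j + 1) (by omega)
  refine ((tests_eq _ _).and (tests_eq _ _)).congr ?_
  simp only [← add_assoc] at h1 h2
  simp only [literalAddr, eval, ArithOp.eval, LiteralHolds, ← add_assoc, h1, h2]

theorem pairSatTest_tests (q p : ArithExpr) (x : ℕ → ℕ)
    (hx : ∀ i < 2 + 6 * reg 6, mem (reg 3 + i) = x i) : Tests reg mem (pairSatTest q p)
      (PairSat (reg 5) (reg 6) (reg 7) (reg 8) x (q.eval reg mem) (p.eval reg mem)) := by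
  -- For an index that is not a clause, the literal tests read cells about which nothing is known.
  -- Their value does not matter, since it is multiplied by the zero of the first test.
  by_cases hq : q.eval reg mem < reg 6
  · have h := fun j hj => literalTest_tests q p j x (fun i hi => hx _ (by omega)) hj
    exact ((tests_lt _ _).and ((h 0 (by omega)).or ((h 1 (by omega)).or (h 2 (by omega))))).or
      ((tests_lt _ _).not.and (tests_eq _ _))
  · have h1 : (lt q (var 6)).eval reg mem = 0 := by
      rcases tests_lt (reg := reg) (mem := mem) q (var 6) with h | h
      · exact absurd h.1 hq
      · exact h.2
    have h2 : Tests reg mem (and (lt q (var 6)) (or (literalTest q p 0)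
        (or (literalTest q p 1) (literalTest q p 2)))) False :=
      Or.inr ⟨not_false, by simp [ArithExpr.and, eval, ArithOp.eval, h1]⟩
    refine (h2.or ((tests_lt q (var 6)).not.and
      (tests_eq (bin .mod (bin .sub q (var 6)) (var 5)) (bin .div p (var 8))))).congr ?_
    simp only [PairSat, eval, ArithOp.eval, hq, false_and, false_or]

theorem linkTest_tests (r s r' s' : ArithExpr) (x : ℕ → ℕ)
    (hx : ∀ i < 2 + 6 * reg 6, mem (reg 3 + i) = x i) : Tests reg mem (linkTest r s r' s')
      (SelectionLink (reg 9) (PairSat (reg 5) (reg 6) (reg 7) (reg 8) x) (r.eval reg mem)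
        (s.eval reg mem) (r'.eval reg mem) (s'.eval reg mem)) :=
  (tests_lt _ _).and ((tests_eq _ _).and ((tests_lt _ _).and
    (((pairSatTest_tests _ _ x hx).and (tests_eq _ _)).or
      ((pairSatTest_tests _ _ x hx).not.and (tests_eq _ _)))))

theorem adjTest_tests (r s r' s' : ArithExpr) (x : ℕ → ℕ)
    (hx : ∀ i < 2 + 6 * reg 6, mem (reg 3 + i) = x i) : Tests reg mem (adjTest r s r' s')
      (SelectionAdj (reg 9) (PairSat (reg 5) (reg 6) (reg 7) (reg 8) x) (r.eval reg mem)
        (s.eval reg mem) (r'.eval reg mem) (s'.eval reg mem)) :=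
  ((tests_eq _ _).and ((tests_eq _ _).and ((tests_lt _ _).and ((tests_lt _ _).and
    ((tests_eq _ _).and (tests_eq _ _).not))))).or
    ((linkTest_tests _ _ _ _ x hx).or (linkTest_tests _ _ _ _ x hx))

theorem instanceEntry_eval (φ : ThreeCNF) (k t : ℕ)
    (h0 : reg 0 = t) (h4 : reg 4 = φ.numVertices k) (h5 : reg 5 = k)
    (h6 : reg 6 = φ.clauses.length) (h7 : reg 7 = φ.groupSize k) (h8 : reg 8 = φ.groupPairs k)
    (h9 : reg 9 = φ.numSlots k) (hx : ∀ i < 2 + 6 * reg 6, mem (reg 3 + i) = φ.encode.getD i 0)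
    (ht : t < 3 + φ.numVertices k * φ.numVertices k) : instanceEntry.eval reg mem =
      (encodeMDC (φ.contractionGraph k) k (φ.numSlots k - 1)).getD t 0 := by
  classical
  have h := fun r s r' s' => (adjTest_tests r s r' s' (fun i => φ.encode.getD i 0) hx).eval_eq
  have he := fun c => (tests_eq (reg := reg) (mem := mem) (var 0) (lit c)).eval_eq
  have hl := (tests_lt (reg := reg) (mem := mem) (lit 2) (var 0)).eval_eq
  simp only [instanceEntry, eval, ArithOp.eval, h, he, hl, h0]
  match t, ht with
  | 0, _ => simp [h4, encodeMDC]
  | 1, _ => simp [h5, encodeMDC]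
  | 2, _ => simp [h9, encodeMDC]
  | t + 3, ht =>
    rw [encodeMDC_contractionGraph_getD φ k _ t (by omega)]
    simp only [rowOf, colOf, eval, ArithOp.eval]
    simp only [show ¬ t + 3 = 0 by omega, show ¬ t + 3 = 1 by omega, show ¬ t + 3 = 2 by omega,
      show 2 < t + 3 by omega, if_true, if_false, zero_mul, one_mul, zero_add]
    refine if_congr ?_ rfl rfl
    rw [h0, h4, h5, h6, h7, h8, h9, ThreeCNF.pairSat, Nat.add_sub_cancel]

end ArithExpr

/-! ### The program of the reduction -/

namespace RAMProgram

/-- A sequence of assignments. -/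
def assigns (b : ℕ) : List (ℕ × ArithExpr) → RAMProgram
  | [] => .skip
  | (r, e) :: l => .seq (assign b r e) (assigns b l)

/-- The registers after a sequence of assignments. -/
def runAssigns (mem : ℕ → ℕ) : List (ℕ × ArithExpr) → (ℕ → ℕ) → (ℕ → ℕ)
  | [], reg => reg
  | (r, e) :: l, reg => runAssigns mem l (Function.update reg r (e.eval reg mem))

/-- All assigned values are at most `B`. -/
def AssignsLe (B : ℕ) (mem : ℕ → ℕ) : List (ℕ × ArithExpr) → (ℕ → ℕ) → Prop
  | [], _ => True
  | (r, e) :: l, reg =>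
    e.eval reg mem ≤ B ∧ AssignsLe B mem l (Function.update reg r (e.eval reg mem))

/-- The degree of a polynomial time bound for a sequence of assignments. -/
def assignsDeg : List (ℕ × ArithExpr) → ℕ
  | [] => 1
  | (_, e) :: l => e.deg + assignsDeg l + 2

theorem _root_.Nat.pow_add_pow_le {B : ℕ} (hB : 2 ≤ B) (c d : ℕ) :
    B ^ c + B ^ d ≤ B ^ (c + d + 1) := by
  have h1 : B ^ c ≤ B ^ (c + d) := Nat.pow_le_pow_right (by omega) (by omega)
  have h2 : B ^ d ≤ B ^ (c + d) := Nat.pow_le_pow_right (by omega) (by omega)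
  calc B ^ c + B ^ d ≤ B ^ (c + d) * 2 := by omega
    _ ≤ B ^ (c + d) * B := Nat.mul_le_mul_left _ hB
    _ = _ := (pow_succ _ _).symm

theorem assigns_halts {b B : ℕ} (hB : 2 ≤ B) (l : List (ℕ × ArithExpr))
    (hl : ∀ x ∈ l, x.2.varBound ≤ b) (reg : ℕ → ℕ) (s : RAMState) (hs : ∀ i < b, s.reg i = reg i)
    (hr : ∀ i < b, reg i ≤ B) (hm : ∀ a, s.mem a ≤ B) (hle : AssignsLe B s.mem l reg) :
    (assigns b l).Halts s (B ^ assignsDeg l) (fun s' => s'.mem = s.mem ∧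
      (∀ i < b, s'.reg i = runAssigns s.mem l reg i) ∧ ∀ i < b, s'.reg i ≤ B) := by
  induction l generalizing reg s with
  | nil =>
    exact ⟨_, _, .skip _, Nat.one_le_pow _ _ (by omega), rfl, hs,
      fun i hi => (hs i hi).trans_le (hr i hi)⟩
  | cons x l ih =>
    obtain ⟨r, e⟩ := x
    obtain ⟨h1, h2⟩ := hle
    have hb : e.varBound ≤ b := hl (r, e) (by simp)
    have he : e.eval s.reg s.mem = e.eval reg s.mem :=
      e.eval_congr (fun i hi => hs i (hi.trans_le hb))
    refine Halts.mono ((assign_halts e s hB hb (fun i hi => (hs i hi).trans_le (hr i hi)) hm).seq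
      (T' := B ^ assignsDeg l) ?_) ?_ (fun _ h => h)
    · rintro s' ⟨h3, h4⟩
      rw [← h3] at h2 ⊢
      refine ih (fun x hx => hl x (List.mem_cons_of_mem _ hx)) _ s' (fun i hi => ?_)
        (fun i hi => ?_) (by rwa [h3]) h2
      · rw [h4 i hi, he, Function.update_apply, h3, hs i hi]
      · rw [Function.update_apply]
        split_ifs
        · rwa [h3]
        · exact hr i hi
    · have h3 := Nat.pow_add_pow_le hB e.deg 0
      have h4 := Nat.pow_add_pow_le hB (e.deg + 1) (assignsDeg l)
      have h5 : e.deg + 1 + assignsDeg l + 1 = e.deg + assignsDeg l + 2 := by ring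
      rw [h5] at h4
      simp only [pow_zero, add_zero] at h3
      simp only [assignsDeg]
      omega

/-! ### Parameters and main program of the reduction -/

open ArithExpr in
/-- The parameters of the reduction that are computed before the number of pairs. -/
def firstParameters : List (ℕ × ArithExpr) :=
  [(6, ld (lit 1)), (7, bin .add (bin .div (ld (lit 0)) (var 5)) (lit 1))]

open ArithExpr in
/-- The other parameters of the reduction. -/
def lastParameters : List (ℕ × ArithExpr) :=
  [(11, bin .add (var 6) (bin .mul (var 5) (bin .add (bin .mul (lit 2) (var 5)) (lit 1)))),
    (8, bin .mul (var 8) (bin .add (var 11) (lit 2))),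
    (9, bin .mul (lit 2) (bin .mul (var 5) (var 8))),
    (4, bin .mul (bin .add (var 11) (lit 1)) (bin .add (var 9) (lit 1))),
    (3, bin .add (lit 3) (bin .mul (var 4) (var 4))),
    (10, bin .add (lit 2) (bin .mul (lit 6) (var 6))),
    (1, var 10), (2, var 3)]

/-- `reg 8 := 2 ^ reg 7`. -/
def pairPower : RAMProgram := .seq (.copy 12 7) (.seq (powTwo 12) (.copy 8 12))

/-- The program that computes the parameters of the reduction. -/
def parameters (k : ℕ) : RAMProgram :=
  .seq (.const 5 k) (.seq (assigns 12 firstParameters)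
    (.seq pairPower (assigns 12 lastParameters)))

/-- The program that replaces the formula by the instance of Maximum Degree Contraction; the
registers are not cleared at the end. -/
def reductionCore (k : ℕ) : RAMProgram :=
  .seq (parameters k) (.seq (fill 12 2 1 0 (.ld (.var 0)))
    (.seq (assigns 12 [(1, .var 3), (2, .lit 0)]) (.seq (fill 12 2 1 0 ArithExpr.instanceEntry)
    (.seq (assigns 12 [(1, .var 10), (2, .var 3)]) (fill 12 2 1 0 (.lit 0))))))

theorem pairPower_halts (s : RAMState) {B : ℕ} (hB : 2 ≤ B) (h7 : s.reg 7 ≤ B) :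
    pairPower.Halts s (B ^ 4) (fun s' => s'.mem = s.mem ∧
      ∀ i < 12, s'.reg i = Function.update s.reg 8 (2 ^ s.reg 7) i) := by
  have h4 : 3 * s.reg 7 + 6 ≤ B ^ 4 := by
    calc 3 * s.reg 7 + 6 ≤ 2 ^ 3 * B := by omega
      _ ≤ B ^ 3 * B := Nat.mul_le_mul_right _ (Nat.pow_le_pow_left hB 3)
      _ = _ := (pow_succ _ _).symm
  refine Halts.mono (Halts.seq (LoopFree.halts (by simp [LoopFree]) s)
    (T' := (3 * s.reg 7 + 4) + 1) ?_) (by simp only [len]; omega) (fun _ h => h)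
  rintro _ rfl
  have h := powTwo_halts 12 (exec (.copy 12 7) s)
  have e1 : (exec (.copy 12 7) s).reg 12 = s.reg 7 := by simp [exec, RAMState.setReg]
  rw [e1] at h
  refine h.seq ?_
  rintro s' ⟨h1, h2, h3⟩
  refine LoopFree.halts_of (by simp [LoopFree]) le_rfl ⟨by simpa [exec, RAMState.setReg] using h1,
    fun i hi => ?_⟩
  have h5 : s'.reg i = s.reg i := by
    rw [h2 i hi]
    simp [exec, RAMState.setReg, Nat.ne_of_lt hi]
  simp [exec, RAMState.setReg, Function.update_apply, h3, h5]

theorem fill_time_le_pow {B : ℕ} (hB : 2 ≤ B) (d : ℕ) : B * (B ^ d + 6) + 2 ≤ B ^ (d + 5) := by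
  have h1 : 1 ≤ B ^ d := Nat.one_le_pow _ _ (by omega)
  calc B * (B ^ d + 6) + 2 ≤ B * (B ^ d * 7) + B * B ^ d := by
        have : B * (B ^ d + 6) ≤ B * (B ^ d * 7) := Nat.mul_le_mul_left _ (by omega)
        have : B * 1 ≤ B * B ^ d := Nat.mul_le_mul_left _ h1
        omega
    _ = B ^ (d + 1) * 2 ^ 3 := by ring
    _ ≤ B ^ (d + 1) * B ^ 3 := by gcongr
    _ ≤ B ^ (d + 1) * B ^ 4 := by gcongr <;> omega
    _ = _ := by rw [← pow_add]

theorem _root_.Nat.add_le_pow {B : ℕ} (hB : 2 ≤ B) {x y c d : ℕ} (hx : x ≤ B ^ c)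
    (hy : y ≤ B ^ d) : x + y ≤ B ^ (c + d + 1) :=
  (Nat.add_le_add hx hy).trans (Nat.pow_add_pow_le hB c d)

/-- The degree of a polynomial time bound for the computation of the parameters. -/
def parametersDeg : ℕ :=
  0 + (assignsDeg firstParameters + (4 + assignsDeg lastParameters + 1) + 1) + 1

/-- The degree of a polynomial time bound for the reduction. -/
def reductionDeg : ℕ :=
  parametersDeg + (((ArithExpr.ld (.var 0)).deg + 5) + (assignsDeg [(1, .var 3), (2, .lit 0)] +
    ((ArithExpr.instanceEntry.deg + 5) + (assignsDeg [(1, .var 10), (2, .var 3)] +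
    ((ArithExpr.lit 0).deg + 5) + 1) + 1) + 1) + 1) + 1

theorem _root_.encodeMDC_getD_le {n : ℕ} (G : SimpleGraph (Fin n)) (k d t : ℕ) :
    (encodeMDC G k d).getD t 0 ≤ max (max n k) (max d 1) := by
  classical
  match t with
  | 0 => simp [encodeMDC]
  | 1 => simp [encodeMDC]
  | 2 => simp [encodeMDC]
  | t + 3 =>
    rw [encodeMDC_getD]
    split_ifs <;> simp

theorem _root_.length_encodeMDC {n : ℕ} (G : SimpleGraph (Fin n)) (k d : ℕ) :
    (encodeMDC G k d).length = 3 + n * n := by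
  rw [encodeMDC, List.length_cons, List.length_cons, List.length_cons,
    List.length_flatMap_of_length_eq _ (c := n) (fun u => by simp), List.length_finRange]
  ring

/-- The registers `3, …, 10` hold the parameters of the reduction, and the named registers are
bounded. -/
structure HasParameters (φ : ThreeCNF) (k : ℕ) (s : RAMState) : Prop where
  reg3 : s.reg 3 = 3 + φ.numVertices k * φ.numVertices k
  reg4 : s.reg 4 = φ.numVertices k
  reg5 : s.reg 5 = k
  reg6 : s.reg 6 = φ.clauses.length
  reg7 : s.reg 7 = φ.groupSize k
  reg8 : s.reg 8 = φ.groupPairs k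
  reg9 : s.reg 9 = φ.numSlots k
  reg10 : s.reg 10 = 2 + 6 * φ.clauses.length
  le : ∀ i < 12, s.reg i ≤ 3 + φ.numVertices k * φ.numVertices k

theorem HasParameters.of_eq {φ : ThreeCNF} {k : ℕ} {s s' : RAMState} (h : HasParameters φ k s)
    (h' : ∀ i, 3 ≤ i → i < 12 → s'.reg i = s.reg i)
    (hle : ∀ i < 3, s'.reg i ≤ 3 + φ.numVertices k * φ.numVertices k) :
    HasParameters φ k s' where
  reg3 := by rw [h' 3 (by omega) (by omega), h.reg3]
  reg4 := by rw [h' 4 (by omega) (by omega), h.reg4]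
  reg5 := by rw [h' 5 (by omega) (by omega), h.reg5]
  reg6 := by rw [h' 6 (by omega) (by omega), h.reg6]
  reg7 := by rw [h' 7 (by omega) (by omega), h.reg7]
  reg8 := by rw [h' 8 (by omega) (by omega), h.reg8]
  reg9 := by rw [h' 9 (by omega) (by omega), h.reg9]
  reg10 := by rw [h' 10 (by omega) (by omega), h.reg10]
  le i hi := by
    by_cases h3 : i < 3
    · exact hle i h3
    · rw [h' i (by omega) hi]
      exact h.le i hi

theorem encode_le {k : ℕ} (hk : 0 < k) (φ : ThreeCNF) (a : ℕ) :
    φ.encode.getD a 0 ≤ 3 + φ.numVertices k * φ.numVertices k := by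
  have h1 := φ.encode_getD_le a
  have b1 := φ.numVars_le_numVertices hk
  have b2 := φ.clauses_le_numVertices hk
  have h2 : 2 * φ.numVertices k ≤ φ.numVertices k * φ.numVertices k :=
    Nat.mul_le_mul_right _ (by omega)
  omega

theorem parameters_halts {k : ℕ} (hk : 0 < k) (φ : ThreeCNF) :
    (parameters k).Halts (RAMState.init φ.encode)
      ((3 + φ.numVertices k * φ.numVertices k) ^ parametersDeg) (fun s' =>
        s'.mem = (RAMState.init φ.encode).mem ∧ HasParameters φ k s' ∧
        s'.reg 1 = 2 + 6 * φ.clauses.length ∧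
        s'.reg 2 = 3 + φ.numVertices k * φ.numVertices k) := by
  have hmem : ∀ a, (RAMState.init φ.encode).mem a ≤ 3 + φ.numVertices k * φ.numVertices k :=
    encode_le hk φ
  have hm0 : (RAMState.init φ.encode).mem 0 = φ.numVars := rfl
  have hm1 : (RAMState.init φ.encode).mem 1 = φ.clauses.length := rfl
  have hreg : (RAMState.init φ.encode).reg = fun _ => 0 := rfl
  have b1 := φ.numVars_le_numVertices hk
  have b2 := φ.clauses_le_numVertices hk
  have b3 := φ.le_numVertices (k := k)
  have b4 := φ.groupSize_le_numVertices hk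
  have b5 := φ.groupPairs_le_numVertices hk
  have b6 := φ.two_pow_le_numVertices hk
  have b7 := φ.numSlots_lt_numVertices (k := k)
  have b8 := φ.numConstraints_lt_numVertices (k := k)
  have hnB : φ.numVertices k ≤ φ.numVertices k * φ.numVertices k := Nat.le_mul_self _
  have e1 : φ.numVars / k + 1 = φ.groupSize k := rfl
  have e2 : φ.clauses.length + k * (2 * k + 1) = φ.numConstraints k := rfl
  have e3 : 2 ^ φ.groupSize k * (φ.numConstraints k + 2) = φ.groupPairs k := rfl
  have e4 : 2 * (k * φ.groupPairs k) = φ.numSlots k := rfl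
  have e5 : (φ.numConstraints k + 1) * (φ.numSlots k + 1) = φ.numVertices k := rfl
  obtain ⟨B, hB⟩ : ∃ B, B = 3 + φ.numVertices k * φ.numVertices k := ⟨_, rfl⟩
  rw [← hB] at hmem ⊢
  have hB2 : 2 ≤ B := by omega
  generalize RAMState.init φ.encode = s₀ at *
  refine Halts.mono ((LoopFree.halts (by simp [LoopFree]) s₀).seq (?_ : ∀ s', _ → Halts _ s'
    (B ^ assignsDeg firstParameters + (B ^ 4 + B ^ assignsDeg lastParameters)) _))
    (Nat.add_le_pow hB2 (by simp [len]) (Nat.add_le_pow hB2 le_rfl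
      (Nat.add_le_pow hB2 le_rfl le_rfl))) (fun _ h => h)
  rintro _ rfl
  refine (assigns_halts hB2 firstParameters ?_ _ _ (fun _ _ => rfl) ?_ ?_ ?_).seq ?_
  · simp [firstParameters, ArithExpr.varBound]
  · intro i _
    simp only [exec, RAMState.setReg, hreg, Function.update_apply]
    split_ifs <;> omega
  · exact hmem
  · simp [firstParameters, AssignsLe, ArithExpr.eval, ArithOp.eval, exec, RAMState.setReg, hm0, hm1,
      e1]
    omega
  rintro s ⟨hs1, hs2, hs3⟩
  rw [show (exec (.const 5 k) s₀).mem = s₀.mem from rfl] at hs1 hs2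
  have r5 := hs2 5 (by omega)
  have r6 := hs2 6 (by omega)
  have r7 := hs2 7 (by omega)
  simp [firstParameters, runAssigns, ArithExpr.eval, ArithOp.eval, exec, RAMState.setReg, hm0, hm1,
    e1] at r5 r6 r7
  refine (pairPower_halts s hB2 (hs3 7 (by omega))).seq ?_
  rintro s' ⟨hs4, hs5⟩
  have r5' := hs5 5 (by omega)
  have r6' := hs5 6 (by omega)
  have r7' := hs5 7 (by omega)
  have r8' := hs5 8 (by omega)
  simp [r5, r6, r7] at r5' r6' r7' r8'
  have hle : ∀ i < 12, s'.reg i ≤ B := fun i hi => by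
    rw [hs5 i hi, Function.update_apply]
    split_ifs
    · rw [r7]
      omega
    · exact hs3 i hi
  have hm' : ∀ a, s'.mem a ≤ B := by rwa [hs4, hs1]
  refine Halts.mono (assigns_halts hB2 lastParameters ?_ _ _ (fun _ _ => rfl) hle hm' ?_) le_rfl ?_
  · simp [lastParameters, ArithExpr.varBound]
  · simp [lastParameters, AssignsLe, ArithExpr.eval, ArithOp.eval, r5', r6', r8', e2, e3, e4, e5]
    omega
  · rintro s'' ⟨h1, h2, h3⟩
    have q1 := h2 1 (by omega)
    have q2 := h2 2 (by omega)
    have q3 := h2 3 (by omega)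
    have q4 := h2 4 (by omega)
    have q5 := h2 5 (by omega)
    have q6 := h2 6 (by omega)
    have q7 := h2 7 (by omega)
    have q8 := h2 8 (by omega)
    have q9 := h2 9 (by omega)
    have q10 := h2 10 (by omega)
    simp [lastParameters, runAssigns, ArithExpr.eval, ArithOp.eval, r5', r6', r7', r8', e2, e3, e4,
      e5] at q1 q2 q3 q4 q5 q6 q7 q8 q9 q10
    exact ⟨by rw [h1, hs4, hs1], ⟨q3, q4, q5, q6, q7, q8, q9, q10, hB ▸ h3⟩, q1, hB ▸ q2⟩

/-- With `B = 3 + n * n`, the instance fills the cells below `B`, where the formula is stored. So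
the formula is copied to the cells from `B` on and read there, and the copy is zeroed at the end,
because an initial state has zeros outside its input. The same `B` bounds all relevant registers and
cells, so every phase takes time polynomial in `B`. -/
theorem reductionCore_halts {k : ℕ} (hk : 0 < k) (φ : ThreeCNF) :
    (reductionCore k).Halts (RAMState.init φ.encode)
      ((3 + φ.numVertices k * φ.numVertices k) ^ reductionDeg) (fun s' => s'.mem =
        (RAMState.init (encodeMDC (φ.contractionGraph k) k (φ.numSlots k - 1))).mem) := by
  have hmem : ∀ a, (RAMState.init φ.encode).mem a ≤ 3 + φ.numVertices k * φ.numVertices k :=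
    encode_le hk φ
  have hmdc := encodeMDC_getD_le (φ.contractionGraph k) k (φ.numSlots k - 1)
  have hpar := parameters_halts hk φ
  have b2 := φ.clauses_le_numVertices hk
  have b3 := φ.le_numVertices (k := k)
  have b7 := φ.numSlots_lt_numVertices (k := k)
  have hnB : φ.numVertices k ≤ φ.numVertices k * φ.numVertices k := Nat.le_mul_self _
  obtain ⟨B, hB⟩ : ∃ B, B = 3 + φ.numVertices k * φ.numVertices k := ⟨_, rfl⟩
  have hB2 : 2 ≤ B := by omega
  have hmdcB : ∀ a, (encodeMDC (φ.contractionGraph k) k (φ.numSlots k - 1)).getD a 0 ≤ B :=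
    fun a => (hmdc a).trans (by omega)
  have hM : ∀ a, (RAMState.init φ.encode).mem a = φ.encode.getD a 0 := fun _ => rfl
  rw [← hB] at hmem hpar ⊢
  refine Halts.mono (hpar.seq (?_ : ∀ s', _ → Halts _ s'
    ((B * (B ^ (ArithExpr.ld (.var 0)).deg + 6) + 2) + (B ^ assignsDeg [(1, .var 3), (2, .lit 0)] +
    ((B * (B ^ ArithExpr.instanceEntry.deg + 6) + 2) +
    (B ^ assignsDeg [(1, .var 10), (2, .var 3)] +
    (B * (B ^ (ArithExpr.lit 0).deg + 6) + 2))))) _))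
    (Nat.add_le_pow hB2 le_rfl (Nat.add_le_pow hB2 (fill_time_le_pow hB2 _)
      (Nat.add_le_pow hB2 le_rfl (Nat.add_le_pow hB2 (fill_time_le_pow hB2 _)
      (Nat.add_le_pow hB2 le_rfl (fill_time_le_pow hB2 _)))))) (fun _ h => h)
  rintro s ⟨hs, hp, h1, h2⟩
  have hpB := hp.le
  rw [← hB] at hpB
  have fillPar : ∀ {s s' : RAMState}, HasParameters φ k s →
      (∀ j < 12, j ≠ 1 → j ≠ 0 → s'.reg j = s.reg j) → s'.reg 1 = 0 → s'.reg 0 = s.reg 1 →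
      HasParameters φ k s' := by
    intro s s' hp h1 h2 h3
    refine hp.of_eq (fun i hi hi' => h1 i hi' (by omega) (by omega)) (fun i hi => ?_)
    interval_cases i
    · rw [h3]
      exact hp.le 1 (by omega)
    · omega
    · rw [h1 2 (by omega) (by omega) (by omega)]
      exact hp.le 2 (by omega)
  -- copy the formula
  refine (fill_halts (.ld (.var 0)) s hB2 (by omega) (by omega) (by omega) (by omega) (by omega)
    (by omega) (by simp [ArithExpr.varBound]) hpB (by rwa [hs]) (fun i => φ.encode.getD i 0)
    (fun i _ => hmem i) ?_).seq ?_
  · intro i hi s' _ h4 h5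
    simp only [ArithExpr.eval, h4]
    rw [h5 i (by omega), hs, hM]
  rintro s1 ⟨g1, g2, g3, g4⟩
  have hp1 := fillPar hp g1 g2 g3
  have hpB1 := hp1.le
  rw [← hB] at hpB1
  rw [h1, h2, hs] at g4
  have hm1 : ∀ a, s1.mem a ≤ B := fun a => by
    rw [g4]
    split_ifs
    · exact hmem _
    · exact hmem _
  refine (assigns_halts hB2 _ (by simp [ArithExpr.varBound]) _ _ (fun _ _ => rfl) hpB1 hm1
    (by simpa [AssignsLe, ArithExpr.eval] using hpB1 3 (by omega))).seq ?_
  rintro s2 ⟨g5, g6, hpB2⟩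
  have hp2 : HasParameters φ k s2 := hp1.of_eq (fun i hi hi' => by
    rw [g6 i hi']
    simp [runAssigns, show i ≠ 1 by omega, show i ≠ 2 by omega])
    (fun i hi => hB ▸ hpB2 i (by omega))
  have c1 : s2.reg 1 = B := by
    rw [g6 1 (by omega)]
    simp [runAssigns, ArithExpr.eval, hp1.reg3, hB]
  have c2 : s2.reg 2 = 0 := by
    rw [g6 2 (by omega)]
    simp [runAssigns, ArithExpr.eval]
  -- write the instance
  refine (fill_halts ArithExpr.instanceEntry s2 hB2 (by omega) (by omega) (by omega) (by omega)
    (by omega) (by omega) (by decide) hpB2 (by rwa [g5])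
    (fun i => (encodeMDC (φ.contractionGraph k) k (φ.numSlots k - 1)).getD i 0)
    (fun i _ => hmdcB i) ?_).seq ?_
  · intro i hi s' h3 h4 h5
    have h3' := fun (j : ℕ) (hj : 3 ≤ j) (hj' : j < 12) => h3 j hj' (by omega) (by omega)
    rw [c1] at hi
    have r3 := (h3' 3 (by omega) (by omega)).trans hp2.reg3
    have r6 := (h3' 6 (by omega) (by omega)).trans hp2.reg6
    refine ArithExpr.instanceEntry_eval φ k i h4 ((h3' 4 (by omega) (by omega)).trans hp2.reg4)
      ((h3' 5 (by omega) (by omega)).trans hp2.reg5) r6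
      ((h3' 7 (by omega) (by omega)).trans hp2.reg7)
      ((h3' 8 (by omega) (by omega)).trans hp2.reg8)
      ((h3' 9 (by omega) (by omega)).trans hp2.reg9) (fun j hj => ?_) (by omega)
    -- The copy starts at `B`, beyond the block being written, so it is still intact.
    rw [h5 _ (by omega), g5, g4, if_pos (by omega), r3, ← hB, Nat.add_sub_cancel_left]
  rintro s3 ⟨g7, g8, g9, g10⟩
  have hp3 := fillPar hp2 g7 g8 g9
  have hpB3 := hp3.le
  rw [← hB] at hpB3
  rw [c1, c2, g5] at g10
  have hm3 : ∀ a, s3.mem a ≤ B := fun a => by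
    rw [g10]
    split_ifs
    · exact hmdcB _
    · exact hm1 a
  refine (assigns_halts hB2 _ (by simp [ArithExpr.varBound]) _ _ (fun _ _ => rfl) hpB3 hm3
    (by simpa [AssignsLe, ArithExpr.eval] using ⟨hpB3 10 (by omega), hpB3 3 (by omega)⟩)).seq ?_
  rintro s4 ⟨g11, g12, hpB4⟩
  have d1 : s4.reg 1 = 2 + 6 * φ.clauses.length := by
    rw [g12 1 (by omega)]
    simp [runAssigns, ArithExpr.eval, hp3.reg10]
  have d2 : s4.reg 2 = B := by
    rw [g12 2 (by omega)]
    simp [runAssigns, ArithExpr.eval, hp3.reg3, hB]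
  -- erase the copy of the formula
  refine Halts.mono (fill_halts (.lit 0) s4 hB2 (by omega) (by omega) (by omega) (by omega)
    (by omega) (by omega) (by simp [ArithExpr.varBound]) hpB4 (by rwa [g11]) (fun _ => 0)
    (fun i _ => by omega) (fun _ _ _ _ _ _ => rfl)) le_rfl ?_
  rintro s5 ⟨-, -, -, g13⟩
  funext a
  change s5.mem a = (encodeMDC (φ.contractionGraph k) k (φ.numSlots k - 1)).getD a 0
  rw [g13, d1, d2, g11, g10, g4, hM]
  have hlen := length_encodeMDC (φ.contractionGraph k) k (φ.numSlots k - 1)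
  have hlen' := φ.length_encode
  by_cases ha : a < B
  · rw [if_neg (by omega), if_pos (by omega), Nat.sub_zero]
  · have hz : (encodeMDC (φ.contractionGraph k) k (φ.numSlots k - 1)).getD a 0 = 0 :=
      List.getD_eq_default _ _ (by omega)
    rw [hz]
    by_cases ha' : a < B + (2 + 6 * φ.clauses.length)
    · rw [if_pos (by omega)]
    · rw [if_neg (by omega), if_neg (by omega), if_neg (by omega),
        List.getD_eq_default _ _ (by omega)]

/-- The program that replaces the formula by the instance of Maximum Degree Contraction. -/
def reduction (k : ℕ) : RAMProgram :=
  .seq (reductionCore k) (clear (reductionCore k).regBound)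

/-- The final state is exactly the initial state on the instance, so a program for Maximum Degree
Contraction can be run right after the reduction. -/
theorem reduction_runs {k : ℕ} (hk : 0 < k) (φ : ThreeCNF) :
    ∃ t, (reduction k).Runs (RAMState.init φ.encode) t
        (RAMState.init (encodeMDC (φ.contractionGraph k) k (φ.numSlots k - 1))) ∧
      t ≤ (3 + φ.numVertices k * φ.numVertices k) ^ reductionDeg +
        ((reductionCore k).regBound + 1) := by
  obtain ⟨t, s, h1, h2, h3⟩ := reductionCore_halts hk φ
  obtain ⟨t', s', h4, h5, h6, h7⟩ := clear_halts (reductionCore k).regBound s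
  have hs : s' = RAMState.init (encodeMDC (φ.contractionGraph k) k (φ.numSlots k - 1)) := by
    have hreg : s'.reg = fun _ => 0 := by
      funext r
      rw [h7]
      split_ifs with hr
      · rfl
      · rw [h1.reg_eq r (by omega)]
        rfl
    cases s'
    simp only at h6 hreg
    rw [hreg, h6, h3]
    rfl
  exact ⟨t + t', .seq h1 (hs ▸ h4), by omega⟩

end RAMProgram

/-! ### Running times -/

/-- The number of constraints enters twice, through the rows and through the padding of the groups,
which gives the square; the additional factor `2` comes from the `+ 1` in the group size. -/
theorem ThreeCNF.numVertices_le (φ : ThreeCNF) {k : ℕ} (hk : 0 < k) :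
    (φ.numVertices k : ℝ) ≤ (2 * (2 * k + 1) * (k * (2 * k + 1) + 2) ^ 2 : ℕ) *
      ((φ.numVars : ℝ) + φ.clauses.length + 1) ^ 2 * (2 : ℝ) ^ ((φ.numVars : ℝ) / k) := by
  have hL : (2 : ℝ) ^ φ.groupSize k ≤ 2 * (2 : ℝ) ^ ((φ.numVars : ℝ) / k) := by
    rw [ThreeCNF.groupSize, pow_succ, mul_comm, ← Real.rpow_natCast]
    have h : ((φ.numVars / k : ℕ) : ℝ) ≤ (φ.numVars : ℝ) / k := Nat.cast_div_le
    gcongr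
    norm_num
  have hQ : φ.numConstraints k + 2 ≤ (k * (2 * k + 1) + 2) *
      (φ.numVars + φ.clauses.length + 1) := by
    have h1 : 1 * (φ.clauses.length) ≤ (k * (2 * k + 1) + 2) * (φ.numVars + φ.clauses.length) :=
      Nat.mul_le_mul (by omega) (by omega)
    have h2 : (k * (2 * k + 1) + 2) * (φ.numVars + φ.clauses.length + 1) =
        (k * (2 * k + 1) + 2) * (φ.numVars + φ.clauses.length) + (k * (2 * k + 1) + 2) :=
      Nat.mul_succ _ _
    rw [h2, ThreeCNF.numConstraints]
    omega
  have hn : φ.numVertices k ≤ (2 * k + 1) * ((k * (2 * k + 1) + 2) *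
      (φ.numVars + φ.clauses.length + 1)) ^ 2 * 2 ^ φ.groupSize k := by
    have hW : φ.numSlots k + 1 ≤ (2 * k + 1) * ((k * (2 * k + 1) + 2) *
        (φ.numVars + φ.clauses.length + 1)) * 2 ^ φ.groupSize k := by
      have h1 := φ.groupPairs_pos (k := k)
      have h2 : φ.groupPairs k ≤ 2 ^ φ.groupSize k * ((k * (2 * k + 1) + 2) *
        (φ.numVars + φ.clauses.length + 1)) := Nat.mul_le_mul_left _ hQ
      calc φ.numSlots k + 1 ≤ (2 * k + 1) * φ.groupPairs k := by
            rw [ThreeCNF.numSlots, add_mul, mul_assoc]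
            omega
        _ ≤ (2 * k + 1) * (2 ^ φ.groupSize k * ((k * (2 * k + 1) + 2) *
          (φ.numVars + φ.clauses.length + 1))) := Nat.mul_le_mul_left _ h2
        _ = _ := by ring
    calc φ.numVertices k ≤ ((k * (2 * k + 1) + 2) * (φ.numVars + φ.clauses.length + 1)) *
          ((2 * k + 1) * ((k * (2 * k + 1) + 2) *
        (φ.numVars + φ.clauses.length + 1)) * 2 ^ φ.groupSize k) :=
          Nat.mul_le_mul (by omega) hW
      _ = _ := by ring
  have hn' : (φ.numVertices k : ℝ) ≤ (2 * k + 1) * ((k * (2 * k + 1) + 2) *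
      (φ.numVars + φ.clauses.length + 1)) ^ 2 * 2 ^ φ.groupSize k := by exact_mod_cast hn
  calc (φ.numVertices k : ℝ) ≤ (2 * k + 1) * ((k * (2 * k + 1) + 2) *
      (φ.numVars + φ.clauses.length + 1)) ^ 2 * (2 * (2 : ℝ) ^ ((φ.numVars : ℝ) / k)) := by
        refine hn'.trans ?_
        gcongr
    _ = _ := by push_cast; ring

/-- If the exponents of the running time are at most `δ * k`, then the reduction gives an
algorithm for 3-SAT. -/
theorem threeSATSolvable_of_maximumDegreeContraction {δ : ℝ} (P : RAMProgram) (g : ℕ → ℝ)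
    (hP : ∀ (n : ℕ) (G : SimpleGraph (Fin n)) (k d : ℕ), ∃ t : ℕ,
      P.DecidesIn (encodeMDC G k d) (MaximumDegreeContraction G k d) t ∧
      (2 ≤ n → (t : ℝ) ≤ (n : ℝ) ^ g k)) {k : ℕ} (hk : 0 < k)
    (hkδ : 3 * (RAMProgram.reductionDeg : ℝ) + |g k| ≤ δ * k) : ThreeSATSolvable δ := by
  have hrun := fun φ => RAMProgram.reduction_runs hk φ
  generalize RAMProgram.reductionDeg = D at hrun hkδ
  generalize (RAMProgram.reductionCore k).regBound + 1 = c₀ at hrun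
  -- The summand `3 * D` pays for the reduction, as `3 + n * n ≤ n ^ 3` for `n ≥ 3`. The absolute
  -- value makes `E` nonnegative, so that `n ^ E` is monotone in `n`.
  set E : ℝ := 3 * (D : ℝ) + |g k| with hE
  have hE0 : 0 ≤ E := by positivity
  set c₁ : ℕ := 2 * (2 * k + 1) * (k * (2 * k + 1) + 2) ^ 2 with hc₁
  -- A single `c` serves as leading factor and as degree of the polynomial; it depends on `k` but
  -- not on the formula.
  set c : ℕ := max ⌈(2 + c₀) * (c₁ : ℝ) ^ E⌉₊ ⌈2 * E⌉₊ with hc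
  refine ⟨.seq (RAMProgram.reduction k) P, c, fun φ => ?_⟩
  obtain ⟨t, ⟨s, hs, hsat⟩, ht⟩ := hP _ (φ.contractionGraph k) k (φ.numSlots k - 1)
  obtain ⟨t', hs', ht'⟩ := hrun φ
  refine ⟨t' + t, ⟨s, .seq hs' hs, hsat.trans (φ.maximumDegreeContraction_iff hk)⟩, ?_⟩
  have hn2 := φ.clauses_le_numVertices hk
  have hn3 : 3 ≤ φ.numVertices k := by
    have h1 := φ.numSlots_lt_numVertices (k := k)
    have h2 := φ.numConstraints_add_two_le hk
    omega
  have hle := φ.numVertices_le hk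
  rw [← hc₁] at hle
  replace ht := ht (by omega)
  set n : ℕ := φ.numVertices k with hn
  set S : ℝ := (φ.numVars : ℝ) + φ.clauses.length + 1 with hS
  have hS1 : 1 ≤ S := by
    rw [hS]
    linarith [Nat.cast_nonneg (α := ℝ) φ.numVars, Nat.cast_nonneg (α := ℝ) φ.clauses.length]
  have hn1 : (1 : ℝ) ≤ n := by exact_mod_cast (by omega : 1 ≤ n)
  have h1 : (t : ℝ) ≤ (n : ℝ) ^ E := ht.trans (Real.rpow_le_rpow_of_exponent_le hn1
    ((le_abs_self _).trans (le_add_of_nonneg_left (by positivity))))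
  have h2 : (t' : ℝ) ≤ (n : ℝ) ^ E + c₀ := by
    have h3 : 3 + n * n ≤ n ^ 3 := by
      have h4 : 3 * (n * n) ≤ n * (n * n) := Nat.mul_le_mul_right _ hn3
      have h5 : 3 * 3 ≤ n * n := Nat.mul_le_mul hn3 hn3
      have h6 : n ^ 3 = n * (n * n) := by ring
      omega
    have h4 : t' ≤ n ^ (3 * D) + c₀ := by
      rw [pow_mul]
      exact ht'.trans (Nat.add_le_add_right (Nat.pow_le_pow_left h3 _) _)
    have h5 : (t' : ℝ) ≤ (n : ℝ) ^ (3 * D) + c₀ := by exact_mod_cast h4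
    refine h5.trans ?_
    gcongr
    rw [← Real.rpow_natCast]
    refine Real.rpow_le_rpow_of_exponent_le hn1 ?_
    push_cast
    exact le_add_of_nonneg_right (abs_nonneg _)
  have h3 : (1 : ℝ) ≤ (n : ℝ) ^ E := Real.one_le_rpow hn1 hE0
  have h4 : ((t' + t : ℕ) : ℝ) ≤ (2 + c₀) * (n : ℝ) ^ E := by
    have : (c₀ : ℝ) * 1 ≤ c₀ * (n : ℝ) ^ E := by gcongr
    push_cast
    linarith
  have h5 : (n : ℝ) ^ E ≤ (c₁ : ℝ) ^ E * S ^ c * (2 : ℝ) ^ (δ * φ.numVars) := by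
    have hk' : (0 : ℝ) < k := by exact_mod_cast hk
    calc (n : ℝ) ^ E ≤ (c₁ * S ^ 2 * (2 : ℝ) ^ ((φ.numVars : ℝ) / k)) ^ E :=
          Real.rpow_le_rpow (by positivity) hle hE0
      _ = (c₁ : ℝ) ^ E * S ^ (2 * E) * (2 : ℝ) ^ ((φ.numVars : ℝ) / k * E) := by
          rw [Real.mul_rpow (by positivity) (by positivity),
            Real.mul_rpow (by positivity) (by positivity), ← Real.rpow_natCast S 2,
            ← Real.rpow_mul (by positivity), ← Real.rpow_mul (by positivity)]
          norm_num
      _ ≤ (c₁ : ℝ) ^ E * S ^ c * (2 : ℝ) ^ (δ * φ.numVars) := by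
          have h6 : S ^ (2 * E) ≤ S ^ c := by
            rw [← Real.rpow_natCast]
            exact Real.rpow_le_rpow_of_exponent_le hS1 ((Nat.le_ceil _).trans
              (Nat.cast_le.2 (le_max_right _ _)))
          have h7 : (φ.numVars : ℝ) / k * E ≤ δ * φ.numVars := by
            rw [div_mul_eq_mul_div, div_le_iff₀ hk']
            calc (φ.numVars : ℝ) * E ≤ φ.numVars * (δ * k) := by gcongr
              _ = _ := by ring
          gcongr
          norm_num
  calc ((t' + t : ℕ) : ℝ) ≤ (2 + c₀) * ((c₁ : ℝ) ^ E * S ^ c * (2 : ℝ) ^ (δ * φ.numVars)) :=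
        h4.trans (by gcongr)
    _ = ((2 + c₀) * (c₁ : ℝ) ^ E) * S ^ c * (2 : ℝ) ^ (δ * φ.numVars) := by ring
    _ ≤ c * S ^ c * (2 : ℝ) ^ (δ * φ.numVars) := by
        gcongr
        exact (Nat.le_ceil _).trans (Nat.cast_le.2 (le_max_left _ _))

theorem theorem1 (hETH : ExponentialTimeHypothesis) :
    ¬ ∃ (P : RAMProgram) (g : ℕ → ℝ),
      Asymptotics.IsLittleO Filter.atTop g (fun k : ℕ => (k : ℝ)) ∧
      ∀ (n : ℕ) (G : SimpleGraph (Fin n)) (k d : ℕ), ∃ t : ℕ,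
        P.DecidesIn (encodeMDC G k d) (MaximumDegreeContraction G k d) t ∧
        (2 ≤ n → (t : ℝ) ≤ (n : ℝ) ^ g k) := by
  rintro ⟨P, g, hg, hP⟩
  obtain ⟨δ, hδ, hno⟩ := hETH
  -- Half of `δ * k` is for `|g k|`, and the other half for the constant exponent of the reduction.
  have h1 := hg.def (half_pos hδ)
  have h2 : ∀ᶠ k : ℕ in Filter.atTop, 3 * (RAMProgram.reductionDeg : ℝ) / (δ / 2) ≤ k :=
    tendsto_natCast_atTop_atTop.eventually_ge_atTop _
  obtain ⟨k, ⟨h1, h2⟩, hk⟩ := ((h1.and h2).and (Filter.eventually_gt_atTop 0)).exists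
  refine hno (threeSATSolvable_of_maximumDegreeContraction P g hP hk ?_)
  rw [div_le_iff₀ (half_pos hδ)] at h2
  rw [Real.norm_eq_abs, Real.norm_eq_abs, Nat.abs_cast] at h1
  linarith
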